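/- Let $n\ge 0$ be an integer and let $G$ be a finite group. **Compositions.** For a set $L$, an $L$-composition of $[n]=\{1,\dots,n\}$ is a tuple $s=((S_1,g_1),\dots,(S_k,g_k))$ where $S_1,\dots,S_k$ are nonempty, pairwise disjoint subsets with union $[n]$ and $g_i\in L$; put $\ell(s)=k$, and let $|s|=(S_1,\dots,S_k)$ be its underlying set composition. An $L$-composition of the integer $n$ is a tuple $p=((a_1,g_1),\dots,(a_k,g_k))$ of positive integers $a_i$ with sum $n$ and labels $g_i\in L$; put $\ell(p)=k$ and $|p|=(a_1,\dots,a_k)$. Write $\Sigma_n[L]$ and $\Gamma_n[L]$ for these sets, and $\mathsf{type}:\Sigma_n[L]\to\Gamma_n[L]$ for the map $S_i\mapsto |S_i|$ on blocks; its fibres are the orbits of the symmetric group $\mathfrak S_n$. **Orders.** For $s,t$ both in $\Sigma_n[L]$ or both in $\Gamma_n[L]$, say that $t$ refines $s$ if the blocks of $t$ can be grouped into consecutive runs, one for each block of $s$, the blocks of a run having union (respectively sum) the corresponding block of $s$. Write $s\le t$ if moreover all labels in each run equal the label of the corresponding block of $s$; if $L$ is an abelian group, write $s\preceq t$ if $t$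 refines $s$ and the product of the labels in each run equals the label of the corresponding block of $s$. When $t$ refines $s$ let $m_i$ be the number of blocks in the $i$-th run, and put $\deg(t/s)=\prod_i m_i$ and $\deg!(t/s)=\prod_i m_i!$. **The algebra.** $\Sigma_n[G]$ is a semigroup under $((S_i,g_i))_i\cdot((T_j,h_j))_j=((S_i\cap T_j,\,h_jg_i))_{(i,j)}$, with $(i,j)$ in lexicographic order and pairs with empty intersection omitted. Let $\mathbb C\Sigma_n[G]$ be its semigroup algebra with basis $H_s$. Identify a set composition $x$ with the idempotent all of whose labels are $1$. For a set partition $X$ of $[n]$ let $u_X$ be the average of the $H_x$ over all set compositions $x$ with set of blocks $\mathsf{supp}(x)=X$ (the uniform section), and define recursively $e^\circ_X=u_X-\sum_{Y}u_X e^\circ_Y$, the sum being over all proper refinements $Y$ of $X$. Put $Q^\circ_x=H_x e^\circ_{\mathsf{supp}(x)}$ for a set composition $x$, $R_s=H_s\,e^\circ_{\mathsf{supp}(|s|)}$ for $s\in\Sigma_n[G]$, and for $p\in\Gamma_n[G]$ let $\mathcal H_p=\sum_{\mathsf{type}(s)=p}H_s$ and $\mathcal R_p=\sum_{\mathsf{type}(s)=p}R_s$.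 If $G$ is abelian, let $\widehat G=\mathrm{Hom}(G,\mathbb C^\times)$. For $\phi\in\Sigma_n[\widehat G]$ and $s\in\Sigma_n[G]$ with $|\phi|=|s|$ put $\phi(s)=\prod_i\phi_i(g_i)$, and define $\alpha(p)$ in the same way for $\alpha\in\Gamma_n[\widehat G]$, $p\in\Gamma_n[G]$ with $|\alpha|=|p|$. Put $E_\phi=|G|^{-\ell(\phi)}\sum_{|s|=|\phi|}\overline{\phi(s)}\,H_s$ and $Q_\phi=E_\phi Q^\circ_{|\phi|}$, and for $\alpha\in\Gamma_n[\widehat G]$ let $\mathcal E_\alpha=\sum_{\mathsf{type}(\phi)=\alpha}E_\phi$ and $\mathcal Q_\alpha=\sum_{\mathsf{type}(\phi)=\alpha}Q_\phi$. **Claim.** (1) For every finite group $G$ and all $s\in\Sigma_n[G]$, $$H_s=\sum_{t\ge s}\frac1{\deg!(t/s)}R_t,\qquad R_s=\sum_{t\ge s}\frac{(-1)^{\ell(t)-\ell(s)}}{\deg(t/s)}H_t .$$ (2) For every finite group $G$ and all $p\in\Gamma_n[G]$, $$\mathcal R_p=\sum_{q\ge p}\frac{(-1)^{\ell(q)-\ell(p)}}{\deg(q/p)}\mathcal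 H_q .$$ (3) For every finite abelian group $G$ and all $\phi\in\Sigma_n[\widehat G]$, $$E_\phi=\sum_{\psi\succeq\phi}\frac1{\deg!(\psi/\phi)}Q_\psi,\qquad Q_\phi=\sum_{\psi\succeq\phi}\frac{(-1)^{\ell(\psi)-\ell(\phi)}}{\deg(\psi/\phi)}E_\psi .$$ (4) For every finite abelian group $G$ and all $\alpha\in\Gamma_n[\widehat G]$, $$\mathcal Q_\alpha=\frac1{|G|^{\ell(\alpha)}}\sum_{|p|=|\alpha|}\overline{\alpha(p)}\,\mathcal R_p,\qquad \mathcal Q_\alpha=\sum_{\beta\succeq\alpha}\frac{(-1)^{\ell(\beta)-\ell(\alpha)}}{\deg(\beta/\alpha)}\mathcal E_\beta .$$ -/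

import Mathlib

open scoped Classical

/-! ### Labelled set compositions -/

/-- An `L`-composition of `[n]`: an ordered list of pairs `(S_i, g_i)`, where the `S_i` are
nonempty, pairwise disjoint subsets with union `[n]`, and `g_i ∈ L`.  For `L = G` a group this is
an element of `Σ_n[G]`; for `L = Unit` it is an (unlabelled) set composition. -/
@[ext]
structure LSetComp (n : ℕ) (L : Type*) where
  blocks : List (Finset (Fin n) × L)
  nonempty : ∀ b ∈ blocks, b.1.Nonempty
  disjoint : blocks.Pairwise fun a b => Disjoint a.1 b.1
  cover : ∀ i, ∃ b ∈ blocks, i ∈ b.1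

/-- Set compositions of `[n]`. -/
abbrev SetComp (n : ℕ) : Type := LSetComp n Unit

/-- An `L`-composition of the integer `n`: an ordered list of pairs `(a_i, g_i)`, where the `a_i`
are positive integers with sum `n`, and `g_i ∈ L`. -/
@[ext]
structure LIntComp (n : ℕ) (L : Type*) where
  blocks : List (ℕ × L)
  pos : ∀ b ∈ blocks, 0 < b.1
  sum_eq : (blocks.map Prod.fst).sum = n

/-- The character group `Hom(G, ℂ^×)`. -/
abbrev CharGroup (G : Type*) [CommGroup G] : Type _ := G →* ℂˣ

/-- `q` is the concatenation of consecutive (possibly empty) lists, one for each entry of `p`,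
such that the list corresponding to an entry is related to it by `r`. -/
def GroupsInto {A B : Type*} (r : A → List B → Prop) (p : List A) (q : List B) : Prop :=
  ∃ gs : List (List B), gs.flatten = q ∧ List.Forall₂ r p gs

namespace LIntComp

variable {n : ℕ} {L : Type*}

/-- The number of blocks. -/
def length (p : LIntComp n L) : ℕ := p.blocks.length

/-- The underlying integer composition. -/
def abs (p : LIntComp n L) : Composition n where
  blocks := p.blocks.map Prod.fst
  blocks_pos := by
    intro i hi
    obtain ⟨b, hb, rfl⟩ := List.mem_map.1 hi
    exact p.pos b hb
  blocks_sum := p.sum_eq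

theorem finite_aux [Finite L] : Finite (LIntComp n L) := by
  have : Finite {l : List L | l.length ≤ n} := List.finite_length_le L n
  refine Finite.of_injective
    (fun p : LIntComp n L =>
      ((p.abs, ⟨p.blocks.map Prod.snd, ?_⟩) : Composition n × {l : List L | l.length ≤ n})) ?_
  · have h := p.abs.length_le
    simpa [Composition.length, abs] using h
  · intro p q h
    simp only [Prod.mk.injEq, Subtype.mk.injEq, Composition.ext_iff, abs] at h
    ext1
    rw [← List.zip_unzip p.blocks, ← List.zip_unzip q.blocks]
    simp only [List.unzip_eq_map, h.1, h.2]

noncomputable instance [Finite L] : Fintype (LIntComp n L) :=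
  haveI := finite_aux (n := n) (L := L)
  Fintype.ofFinite _

/-- `p ≤ q`: `q` is a label-preserving refinement of `p`, that is, the blocks of `q` are grouped
into consecutive runs, one for each block of `p`; the sizes in a run add up to the size of the
block of `p`, and all labels in the run equal its label. -/
instance : LE (LIntComp n L) where
  le p q := GroupsInto
    (fun a g => a.1 = (g.map Prod.fst).sum ∧ ∀ b ∈ g, b.2 = a.2) p.blocks q.blocks

/-- `α ⪯ β`: `β` is a multiplicative refinement of `α`, that is, the blocks of `β` are grouped into
consecutive runs, one for each block of `α`; the sizes in a run add up to the size of the block of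
`α`, and the product of the labels in the run equals its label. -/
def MulLE [CommMonoid L] (p q : LIntComp n L) : Prop := GroupsInto
  (fun a g => a.1 = (g.map Prod.fst).sum ∧ a.2 = (g.map Prod.snd).prod) p.blocks q.blocks

/-- `α(p) = ∏ α_i(p_i)` if `α` and `p` have the same underlying composition; `0` otherwise. -/
noncomputable def eval {G : Type*} [CommGroup G] (α : LIntComp n (CharGroup G))
    (p : LIntComp n G) : ℂ :=
  if α.abs = p.abs then
    (List.zipWith (fun a b => ((a.2 b.2 : ℂˣ) : ℂ)) α.blocks p.blocks).prod
  else 0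

end LIntComp

/-! ### Degrees -/

/-- The number of blocks of `q` that lie within the `i`-th block of `p`, where blocks are regarded
as consecutive intervals.  If `q` refines `p`, this is the length of the composition `(q/p)_i`. -/
def Composition.runLength {n : ℕ} (q p : Composition n) (i : Fin p.length) : ℕ :=
  (Finset.univ.filter fun j : Fin q.length =>
    p.sizeUpTo i ≤ q.sizeUpTo j ∧ q.sizeUpTo (j + 1) ≤ p.sizeUpTo (i + 1)).card

/-- `deg(q/p) = ∏_i ℓ((q/p)_i)`. -/
def Composition.relDeg {n : ℕ} (q p : Composition n) : ℕ :=
  ∏ i : Fin p.length, q.runLength p i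

/-- `deg!(q/p) = ∏_i ℓ((q/p)_i)!`. -/
def Composition.relDegFactorial {n : ℕ} (q p : Composition n) : ℕ :=
  ∏ i : Fin p.length, (q.runLength p i).factorial

namespace LSetComp

variable {n : ℕ} {L M : Type*}

/-- The number of blocks. -/
def length (s : LSetComp n L) : ℕ := s.blocks.length

/-- Apply a map to all labels. -/
def relabel (f : L → M) (s : LSetComp n L) : LSetComp n M where
  blocks := s.blocks.map fun b => (b.1, f b.2)
  nonempty := by
    intro b hb
    obtain ⟨a, ha, rfl⟩ := List.mem_map.1 hb
    exact s.nonempty a ha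
  disjoint := List.pairwise_map.2 s.disjoint
  cover i := by
    obtain ⟨a, ha, hi⟩ := s.cover i
    exact ⟨_, List.mem_map.2 ⟨a, ha, rfl⟩, hi⟩

/-- The underlying set composition `|s|`. -/
def abs (s : LSetComp n L) : SetComp n := s.relabel fun _ => ()

/-- The idempotent of `Σ_n[G]` corresponding to a set composition: all labels are `1`. -/
def ofSetComp (G : Type*) [One G] (x : SetComp n) : LSetComp n G := x.relabel fun _ => 1

theorem nodup_blocks (s : LSetComp n L) : s.blocks.Nodup := by
  refine s.disjoint.imp_of_mem ?_
  rintro a b ha - hab rfl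
  exact (s.nonempty a ha).ne_empty (disjoint_self.1 hab)

theorem finite_aux [Finite L] : Finite (LSetComp n L) := by
  have := Fintype.ofFinite L
  refine Finite.of_injective
    (fun s : LSetComp n L =>
      (⟨s.blocks, s.nodup_blocks⟩ : {l : List (Finset (Fin n) × L) // l.Nodup})) ?_
  intro s t h
  exact LSetComp.ext (Subtype.mk.inj h)

noncomputable instance [Finite L] : Fintype (LSetComp n L) :=
  haveI := finite_aux (n := n) (L := L)
  Fintype.ofFinite _

/-- The set partition underlying `s`, i.e. the support of `|s|`. -/
def supp (s : LSetComp n L) : Finpartition (Finset.univ : Finset (Fin n)) where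
  parts := (s.blocks.map Prod.fst).toFinset
  supIndep := by
    rw [Finset.supIndep_iff_pairwiseDisjoint]
    have h : (s.blocks.map Prod.fst).Pairwise Disjoint := List.pairwise_map.2 s.disjoint
    intro A hA B hB hAB
    exact h.forall (by simpa using hA) (by simpa using hB) hAB
  sup_parts := by
    refine Finset.eq_univ_of_forall fun i => ?_
    obtain ⟨b, hb, hi⟩ := s.cover i
    refine Finset.mem_sup.2 ⟨b.1, ?_, hi⟩
    exact List.mem_toFinset.2 (List.mem_map.2 ⟨b, hb, rfl⟩)
  bot_notMem := by
    intro h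
    obtain ⟨b, hb, h0⟩ := List.mem_map.1 (List.mem_toFinset.1 h)
    exact (s.nonempty b hb).ne_empty h0

theorem sum_card_aux (l : List (Finset (Fin n) × L))
    (h : l.Pairwise fun a b => Disjoint a.1 b.1) :
    (l.map fun b => b.1.card).sum =
      (Finset.univ.filter fun i => ∃ b ∈ l, i ∈ b.1).card := by
  induction l with
  | nil => simp
  | cons a l ih =>
    rw [List.pairwise_cons] at h
    rw [List.map_cons, List.sum_cons, ih h.2, ← Finset.card_union_of_disjoint]
    · congr 1
      ext i
      simp
    · rw [Finset.disjoint_left]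
      intro i hi hi'
      obtain ⟨b, hb, hib⟩ := (Finset.mem_filter.1 hi').2
      exact Finset.disjoint_left.1 (h.1 b hb) hi hib

/-- The type of `s`, obtained by replacing each block by its size. -/
def type (s : LSetComp n L) : LIntComp n L where
  blocks := s.blocks.map fun b => (b.1.card, b.2)
  pos := by
    intro b hb
    obtain ⟨a, ha, rfl⟩ := List.mem_map.1 hb
    exact Finset.card_pos.2 (s.nonempty a ha)
  sum_eq := by
    rw [List.map_map]
    have h := sum_card_aux s.blocks s.disjoint
    rw [Finset.filter_true_of_mem fun i _ => s.cover i, Finset.card_univ, Fintype.card_fin] at h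
    exact h

/-- The permutation `w` acts on the blocks and does not change the labels. -/
instance : MulAction (Equiv.Perm (Fin n)) (LSetComp n L) where
  smul w s :=
    { blocks := s.blocks.map fun b => (b.1.map w.toEmbedding, b.2)
      nonempty := by
        intro b hb
        obtain ⟨a, ha, rfl⟩ := List.mem_map.1 hb
        exact (s.nonempty a ha).map
      disjoint := List.pairwise_map.2
        (s.disjoint.imp fun h => (Finset.disjoint_map _).2 h)
      cover := by
        intro i
        obtain ⟨a, ha, hi⟩ := s.cover (w.symm i)
        exact ⟨_, List.mem_map.2 ⟨a, ha, rfl⟩, Finset.mem_map.2 ⟨_, hi, by simp⟩⟩ }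
  one_smul s := by
    apply LSetComp.ext
    refine (List.map_congr_left fun b _ => ?_).trans (List.map_id _)
    refine Prod.ext ?_ rfl
    ext i
    simp [← Equiv.Perm.inv_def]
  mul_smul w v s := by
    apply LSetComp.ext
    refine Eq.trans (List.map_congr_left fun b _ => ?_) List.map_map.symm
    refine Prod.ext ?_ rfl
    ext i
    simp [← Equiv.Perm.inv_def]

theorem mem_block_unique (s : LSetComp n L) {j k : ℕ} (hj : j < s.blocks.length)
    (hk : k < s.blocks.length) {i : Fin n} (hij : i ∈ s.blocks[j].1) (hik : i ∈ s.blocks[k].1) :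
    j = k := by
  by_contra hne
  rcases Nat.lt_or_gt_of_ne hne with h | h
  · exact Finset.disjoint_left.1 (List.pairwise_iff_getElem.1 s.disjoint j k hj hk h) hij hik
  · exact Finset.disjoint_left.1 (List.pairwise_iff_getElem.1 s.disjoint k j hk hj h) hik hij

/-- The fibres of `type` are exactly the orbits of the symmetric group. -/
theorem type_eq_type_iff (s t : LSetComp n L) :
    s.type = t.type ↔ ∃ w : Equiv.Perm (Fin n), w • s = t := by
  constructor
  · intro h
    have hb : s.blocks.map (fun b => (b.1.card, b.2)) = t.blocks.map (fun b => (b.1.card, b.2)) :=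
      congrArg LIntComp.blocks h
    have hlen : s.blocks.length = t.blocks.length := by
      simpa using congrArg List.length hb
    have hk : ∀ (k : ℕ) (h1 : k < s.blocks.length) (h2 : k < t.blocks.length),
        s.blocks[k].1.card = t.blocks[k].1.card ∧ s.blocks[k].2 = t.blocks[k].2 := by
      intro k h1 h2
      have := List.getElem_of_eq hb (i := k) (by simpa using h1)
      simpa using this
    have hf : ∀ i, ∃ k : Fin s.blocks.length, i ∈ (s.blocks[k.1]'k.2).1 := by
      intro i
      obtain ⟨b, hb, hi⟩ := s.cover i
      obtain ⟨k, hk, rfl⟩ := List.getElem_of_mem hb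
      exact ⟨⟨k, hk⟩, hi⟩
    have hg : ∀ i, ∃ k : Fin s.blocks.length, i ∈ (t.blocks[k.1]'(hlen ▸ k.2)).1 := by
      intro i
      obtain ⟨b, hb, hi⟩ := t.cover i
      obtain ⟨k, hk, rfl⟩ := List.getElem_of_mem hb
      exact ⟨⟨k, hlen ▸ hk⟩, hi⟩
    choose f hf using hf
    choose g hg using hg
    have hf' : ∀ i (k : Fin s.blocks.length), i ∈ (s.blocks[k.1]'k.2).1 ↔ f i = k := by
      intro i k
      constructor
      · intro hi
        exact Fin.ext (s.mem_block_unique (f i).2 k.2 (hf i) hi)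
      · rintro rfl
        exact hf i
    have hg' : ∀ i (k : Fin s.blocks.length),
        i ∈ (t.blocks[k.1]'(hlen ▸ k.2)).1 ↔ g i = k := by
      intro i k
      constructor
      · intro hi
        exact Fin.ext (t.mem_block_unique (hlen ▸ (g i).2) (hlen ▸ k.2) (hg i) hi)
      · rintro rfl
        exact hg i
    have hc : ∀ k, Nonempty ({i // f i = k} ≃ {i // g i = k}) := by
      intro k
      refine ⟨Fintype.equivOfCardEq ?_⟩
      have e1 := Fintype.card_of_subtype (p := fun i => f i = k) _ fun i => hf' i k
      have e2 := Fintype.card_of_subtype (p := fun i => g i = k) _ fun i => hg' i k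
      rw [e1, e2]
      exact (hk k.1 k.2 (hlen ▸ k.2)).1
    let w : Equiv.Perm (Fin n) := (Equiv.sigmaFiberEquiv f).symm.trans
      ((Equiv.sigmaCongrRight fun k => (hc k).some).trans (Equiv.sigmaFiberEquiv g))
    have hw : ∀ i, g (w i) = f i := fun i => ((hc (f i)).some ⟨i, rfl⟩).2
    refine ⟨w, LSetComp.ext ?_⟩
    change s.blocks.map (fun b => (b.1.map w.toEmbedding, b.2)) = t.blocks
    refine List.ext_getElem (by simpa using hlen) ?_
    intro k h1 h2
    have h1' : k < s.blocks.length := by simpa using h1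
    rw [List.getElem_map]
    refine Prod.ext ?_ (hk k h1' h2).2
    ext i
    obtain ⟨j, rfl⟩ := w.surjective i
    have a1 := hf' j ⟨k, h1'⟩
    have a2 := hg' (w j) ⟨k, h1'⟩
    rw [hw] at a2
    simp only [Finset.mem_map_equiv, Equiv.symm_apply_apply]
    exact a1.trans a2.symm
  · rintro ⟨w, rfl⟩
    apply LIntComp.ext
    change s.blocks.map _ = (s.blocks.map _).map _
    simp

/-- `s ≤ t`: `t` is a label-preserving refinement of `s`, that is, the blocks of `t` are grouped
into consecutive runs, one for each block of `s`; the union of the sets in a run is the block of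
`s`, and all labels in the run equal its label. -/
instance : LE (LSetComp n L) where
  le s t := GroupsInto
    (fun a g => (∀ i, i ∈ a.1 ↔ ∃ b ∈ g, i ∈ b.1) ∧ ∀ b ∈ g, b.2 = a.2) s.blocks t.blocks

/-- `φ ⪯ ψ`: `ψ` is a multiplicative refinement of `φ`, that is, the blocks of `ψ` are grouped into
consecutive runs, one for each block of `φ`; the union of the sets in a run is the block of `φ`,
and the product of the labels in the run equals its label. -/
def MulLE [CommMonoid L] (s t : LSetComp n L) : Prop := GroupsInto
  (fun a g => (∀ i, i ∈ a.1 ↔ ∃ b ∈ g, i ∈ b.1) ∧ a.2 = (g.map Prod.snd).prod) s.blocks t.blocks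

/-- `deg(t/s)`, computed on the underlying integer compositions. -/
def relDeg (t s : LSetComp n L) : ℕ := t.type.abs.relDeg s.type.abs

/-- `deg!(t/s)`, computed on the underlying integer compositions. -/
def relDegFactorial (t s : LSetComp n L) : ℕ := t.type.abs.relDegFactorial s.type.abs

/-- `φ(s) = ∏ φ_i(g_i)` if `φ` and `s` have the same underlying set composition; `0` otherwise. -/
noncomputable def eval {G : Type*} [CommGroup G] (φ : LSetComp n (CharGroup G))
    (s : LSetComp n G) : ℂ :=
  if φ.abs = s.abs then
    (List.zipWith (fun a b => ((a.2 b.2 : ℂˣ) : ℂ)) φ.blocks s.blocks).prod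
  else 0

/-! ### The semigroup structure of `Σ_n[G]` -/

/-- All pairs `(S_i ∩ T_j, h_j g_i)`, in lexicographic order of `(i, j)`. -/
def rawMul [Mul L] (l m : List (Finset (Fin n) × L)) : List (Finset (Fin n) × L) :=
  l.flatMap fun a => m.map fun b => (a.1 ∩ b.1, b.2 * a.2)

/-- Omit the pairs whose set is empty. -/
def dropEmpty (l : List (Finset (Fin n) × L)) : List (Finset (Fin n) × L) :=
  l.filter fun b => decide b.1.Nonempty

theorem rawMul_assoc [Semigroup L] (l m k : List (Finset (Fin n) × L)) :
    rawMul (rawMul l m) k = rawMul l (rawMul m k) := by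
  simp only [rawMul, List.flatMap_assoc, List.flatMap_map, List.map_flatMap, List.map_map,
    Function.comp_def, Finset.inter_assoc, mul_assoc]

theorem dropEmpty_map_inter [Mul L] (a : Finset (Fin n) × L) (m : List (Finset (Fin n) × L)) :
    dropEmpty ((dropEmpty m).map fun b => (a.1 ∩ b.1, b.2 * a.2)) =
      dropEmpty (m.map fun b => (a.1 ∩ b.1, b.2 * a.2)) := by
  simp only [dropEmpty, List.filter_map, List.filter_filter]
  congr 1
  refine List.filter_congr fun b _ => ?_
  by_cases h : (a.1 ∩ b.1).Nonempty
  · simp [h, h.mono Finset.inter_subset_right]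
  · simp [h]

theorem dropEmpty_rawMul_right [Mul L] (l m : List (Finset (Fin n) × L)) :
    dropEmpty (rawMul l (dropEmpty m)) = dropEmpty (rawMul l m) := by
  induction l with
  | nil => rfl
  | cons a l ih =>
    have key := dropEmpty_map_inter a m
    simp only [rawMul, List.flatMap_cons, dropEmpty, List.filter_append] at ih key ⊢
    rw [ih, key]

theorem dropEmpty_rawMul_left [Mul L] (l m : List (Finset (Fin n) × L)) :
    dropEmpty (rawMul (dropEmpty l) m) = dropEmpty (rawMul l m) := by
  induction l with
  | nil => rfl
  | cons a l ih =>
    by_cases h : a.1.Nonempty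
    · have e : dropEmpty (a :: l) = a :: dropEmpty l := by simp [dropEmpty, h]
      rw [e]
      simp only [rawMul, List.flatMap_cons, dropEmpty, List.filter_append] at ih ⊢
      rw [ih]
    · have e : dropEmpty (a :: l) = dropEmpty l := by simp [dropEmpty, h]
      rw [e, ih]
      have h0 : a.1 = ∅ := Finset.not_nonempty_iff_eq_empty.1 h
      simp only [rawMul, List.flatMap_cons, dropEmpty, List.filter_append, h0,
        Finset.empty_inter]
      refine (List.append_left_eq_self.2 (List.filter_eq_nil_iff.2 ?_)).symm
      intro x hx
      obtain ⟨b, -, rfl⟩ := List.mem_map.1 hx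
      simp

/-- `st` is the list of the pairs `(S_i ∩ T_j, h_j g_i)` with nonempty intersection, in
lexicographic order of `(i, j)`. -/
instance [Mul L] : Mul (LSetComp n L) where
  mul s t :=
    { blocks := dropEmpty (rawMul s.blocks t.blocks)
      nonempty := by
        intro b hb
        simpa using (List.mem_filter.1 hb).2
      disjoint := by
        refine List.Pairwise.filter _ ?_
        refine List.pairwise_flatMap.2 ⟨fun a _ => ?_, ?_⟩
        · refine List.pairwise_map.2 (t.disjoint.imp fun h => ?_)
          exact h.mono Finset.inter_subset_right Finset.inter_subset_right
        · refine s.disjoint.imp fun h => ?_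
          intro x hx y hy
          obtain ⟨b, -, rfl⟩ := List.mem_map.1 hx
          obtain ⟨c, -, rfl⟩ := List.mem_map.1 hy
          exact h.mono Finset.inter_subset_left Finset.inter_subset_left
      cover := by
        intro i
        obtain ⟨a, ha, hia⟩ := s.cover i
        obtain ⟨b, hb, hib⟩ := t.cover i
        have hi : i ∈ a.1 ∩ b.1 := Finset.mem_inter.2 ⟨hia, hib⟩
        refine ⟨(a.1 ∩ b.1, b.2 * a.2), List.mem_filter.2 ⟨?_, ?_⟩, hi⟩
        · exact List.mem_flatMap.2 ⟨a, ha, List.mem_map.2 ⟨b, hb, rfl⟩⟩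
        · simpa using ⟨i, hi⟩ }

instance [Semigroup L] : Semigroup (LSetComp n L) where
  mul_assoc s t u := by
    apply LSetComp.ext
    change dropEmpty (rawMul (dropEmpty (rawMul s.blocks t.blocks)) u.blocks) =
      dropEmpty (rawMul s.blocks (dropEmpty (rawMul t.blocks u.blocks)))
    rw [dropEmpty_rawMul_left, dropEmpty_rawMul_right, rawMul_assoc]

end LSetComp

/-! ### Bases of the semigroup algebra, for the uniform section -/

namespace Hsiao

section Group

variable {n : ℕ} {G : Type*} [Group G] [Finite G]

/-- The canonical basis element `H_s` of the algebra `ℂΣ_n[G]`. -/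
noncomputable def H (s : LSetComp n G) : MonoidAlgebra ℂ (LSetComp n G) :=
  MonoidAlgebra.single s 1

variable (G) in
/-- The uniform section: `u_X` is the average of the `H_x` over all idempotents `x` of
support `X`. -/
noncomputable def u (X : Finpartition (Finset.univ : Finset (Fin n))) :
    MonoidAlgebra ℂ (LSetComp n G) :=
  (1 / ((Finset.univ.filter fun x : SetComp n => x.supp = X).card : ℂ)) •
    ∑ x : SetComp n with x.supp = X, H (LSetComp.ofSetComp G x)

variable (G) in
/-- The idempotents `e°_X = u_X - ∑_{Y > X} u_X e°_Y`.  Here `Y > X` in the support lattice means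
that `Y` is a proper refinement of `X`, which is `Y < X` for Mathlib's order on partitions. -/
noncomputable def e (X : Finpartition (Finset.univ : Finset (Fin n))) :
    MonoidAlgebra ℂ (LSetComp n G) :=
  u G X - ∑ Y : {Y : Finpartition (Finset.univ : Finset (Fin n)) // Y < X}, u G X * e Y.1
termination_by wellFounded_lt.wrap X
decreasing_by exact Y.2

variable (G) in
/-- `Q°_x = H_x e°_{supp(x)}` for an idempotent `x`. -/
noncomputable def Q₀ (x : SetComp n) : MonoidAlgebra ℂ (LSetComp n G) :=
  H (LSetComp.ofSetComp G x) * e G x.supp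

/-- `R_s = H_s e°_{supp(s^ω)}`, where `s^ω` is the idempotent corresponding to `|s|`. -/
noncomputable def R (s : LSetComp n G) : MonoidAlgebra ℂ (LSetComp n G) :=
  H s * e G s.abs.supp

/-- Sum of the `H_s` over the `S_n`-orbit `p`, i.e. over all `s` of type `p`. -/
noncomputable def SH (p : LIntComp n G) : MonoidAlgebra ℂ (LSetComp n G) :=
  ∑ s : LSetComp n G with s.type = p, H s

/-- Sum of the `R_s` over the `S_n`-orbit `p`, i.e. over all `s` of type `p`. -/
noncomputable def SR (p : LIntComp n G) : MonoidAlgebra ℂ (LSetComp n G) :=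
  ∑ s : LSetComp n G with s.type = p, R s

end Group

section CommGroup

variable {n : ℕ} {G : Type*} [CommGroup G] [Finite G]

open ComplexConjugate in
/-- The isotypic projector of the character `φ` of the group `{s : |s| = |φ|}`, whose order is
`|G|^ℓ(φ)`. -/
noncomputable def E (φ : LSetComp n (CharGroup G)) : MonoidAlgebra ℂ (LSetComp n G) :=
  (1 / (Nat.card G : ℂ) ^ φ.length) • ∑ s : LSetComp n G with s.abs = φ.abs, conj (φ.eval s) • H s

/-- `Q_φ = E_φ Q°_{|φ|}`. -/
noncomputable def Q (φ : LSetComp n (CharGroup G)) : MonoidAlgebra ℂ (LSetComp n G) :=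
  E φ * Q₀ G φ.abs

/-- Sum of the `E_φ` over the `S_n`-orbit `α`, i.e. over all `φ` of type `α`. -/
noncomputable def SE (α : LIntComp n (CharGroup G)) : MonoidAlgebra ℂ (LSetComp n G) :=
  ∑ φ : LSetComp n (CharGroup G) with φ.type = α, E φ

/-- Sum of the `Q_φ` over the `S_n`-orbit `α`, i.e. over all `φ` of type `α`. -/
noncomputable def SQ (α : LIntComp n (CharGroup G)) : MonoidAlgebra ℂ (LSetComp n G) :=
  ∑ φ : LSetComp n (CharGroup G) with φ.type = α, Q φ

end CommGroup

end Hsiao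

/-! ### Lists of consecutive runs -/

/-! The first formula comes from the way `H_s` meets the uniform section. If `y` has the support of
`s`, then `s y = s`, so `H_s u_{supp s} = H_s`. Expanding `u` by the recursion gives `H_s = ∑ H_s
e°_Y` over all `Y` refining `supp s` (`H_eq_sum_e`). Since `e°_Y = u_Y e°_Y`, it remains to know
`H_s u_Y`. As `y` runs over the orderings of `Y`, the product `s y` runs over the label-preserving
refinements `t ≥ s` of support `Y`. These differ only by permutations inside the runs, so there are
`deg!(t/s)` of them, and by symmetry each is hit equally often (`card_mul_eq_div`). Hence `H_s u_Y =
∑ H_t / deg!(t/s)`, and multiplying by `e°_Y` turns `H_t` into `R_t`.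

For the inverse formula, a `t` between `s` and `r` amounts to a cut of every run of `s ≤ r` into
nonempty pieces, and both degrees are multiplicative over runs. The sum of `(-1)^(ℓ(t)-ℓ(s)) /
(deg(t/s) deg!(r/t))` over such `t` therefore factors. The factor of a run of length `m` is the
coefficient of `x^m` in `log (1 + (exp x - 1)) = x` (`sum_splits`, `sum_between`).

Orbit sums follow because the coefficients depend only on types, and each integer composition
refined by the type of `t` is the type of exactly one `s` refined by `t` (`sum_type_sum_refines`).

For abelian `G`, `E` and `Q` are the blockwise Fourier transforms of `H` and `R` (`Q_eq_isotypic`).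
Copying labels to a refinement (`inflate`) and multiplying labels within the blocks of a coarsening
(`merge`) are adjoint for the pairing `φ(s)`. Orthogonality of characters then exchanges `≤` and `⪯`
(`sum_conj_eval_le`), so every expansion along `≤` whose coefficients ignore labels transfers to one
along `⪯` with the same coefficients (`isotypic_sum_le`). -/

theorem List.eq_of_flatten_eq_of_sum_eq {B : Type*} (f : B → ℕ) :
    ∀ {gs gs' : List (List B)}, gs.flatten = gs'.flatten → (∀ b ∈ gs.flatten, 0 < f b) →
      gs.map (fun g => (g.map f).sum) = gs'.map (fun g => (g.map f).sum) → gs = gs'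
  | [], [], _, _, _ => rfl
  | [], _ :: _, _, _, h => by simp at h
  | _ :: _, [], _, _, h => by simp at h
  | g :: gs, g' :: gs', h, hpos, hs => by
    have hnil : ∀ c : List B, (∀ b ∈ c, 0 < f b) → (c.map f).sum = 0 → c = [] := by
      intro c hc h0
      rcases c with _ | ⟨b, c⟩
      · rfl
      · have := hc b (by simp)
        simp at h0
        omega
    simp only [List.map_cons, List.cons.injEq] at hs
    have hpos' := hpos
    rw [h] at hpos'
    simp only [List.flatten_cons] at h hpos hpos'
    have key : g = g' := by
      -- One of the two first runs is a prefix of the other; the excess `c` has total weight `0`,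
      -- hence is empty.
      rcases List.append_eq_append_iff.1 h with ⟨c, rfl, -⟩ | ⟨c, rfl, -⟩
      · have : c = [] := hnil c (fun b hb => hpos' b (by simp [hb])) (by simpa using hs.1)
        simp [this]
      · have : c = [] := hnil c (fun b hb => hpos b (by simp [hb])) (by simpa using hs.1)
        simp [this]
    subst key
    rw [List.eq_of_flatten_eq_of_sum_eq f (List.append_cancel_left h)
      (fun b hb => hpos b (by simp [hb])) hs.2]

theorem List.map_eq_map_of_forall₂ {A B C : Type*} {r : A → B → Prop} {f : A → C} {g : B → C}
    {l : List A} {m : List B} (h : List.Forall₂ r l m) (hfg : ∀ a b, a ∈ l → b ∈ m → r a b → f a = g b) :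
    l.map f = m.map g := by
  induction h with
  | nil => rfl
  | cons h _ ih =>
    simp only [List.map_cons, List.cons.injEq]
    exact ⟨hfg _ _ (by simp) (by simp) h,
      ih fun a b ha hb => hfg a b (by simp [ha]) (by simp [hb])⟩

/-- A list related entrywise to a concatenation is itself a concatenation. -/
theorem List.exists_flatten_of_forall₂ {A B : Type*} {r : A → B → Prop} :
    ∀ {hs : List (List A)} {ks : List B}, List.Forall₂ r hs.flatten ks →
      ∃ Ks : List (List B), Ks.flatten = ks ∧ List.Forall₂ (List.Forall₂ r) hs Ks
  | [], ks, h => ⟨[], by simpa [eq_comm] using h, .nil⟩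
  | g :: hs, ks, h => by
    rw [List.flatten_cons] at h
    have h1 := List.forall₂_take_append _ _ _ h.flip
    have h2 := List.forall₂_drop_append _ _ _ h.flip
    obtain ⟨Ks, hKs, hr⟩ := List.exists_flatten_of_forall₂ h2.flip
    exact ⟨ks.take g.length :: Ks, by simp [hKs], .cons h1.flip hr⟩

/-! ### Degrees in terms of runs -/

/-- The first `i` blocks of `p` absorb exactly the blocks of `q` in the first `i` runs. -/
theorem Composition.sizeUpTo_of_runs {n : ℕ} {q p : Composition n} {ls : List (List ℕ)}
    (hq : ls.flatten = q.blocks) (hp : ls.map List.sum = p.blocks) (i : ℕ) :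
    p.sizeUpTo i = q.sizeUpTo (ls.take i).flatten.length := by
  have h : q.blocks = (ls.take i).flatten ++ (ls.drop i).flatten := by
    rw [← List.flatten_append, List.take_append_drop, hq]
  rw [Composition.sizeUpTo, Composition.sizeUpTo, h, List.take_left, ← hp, ← List.map_take,
    List.sum_flatten]

/-- Partial sums of `q` increase strictly, so the inequalities between partial sums that define
`runLength` become inequalities between indices. The blocks counted are those with index in the
interval occupied by the `i`-th run. -/
theorem Composition.runLength_of_runs {n : ℕ} {q p : Composition n} {ls : List (List ℕ)}
    (hq : ls.flatten = q.blocks) (hp : ls.map List.sum = p.blocks) (i : Fin p.length)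
    (hi : (i : ℕ) < ls.length) : q.runLength p i = ls[(i : ℕ)].length := by
  -- `sizeUpTo` is constant beyond `q.length`, so the comparison with an arbitrary `a` needs `j` to
  -- be an actual index.
  have hlt : ∀ j : Fin q.length, ∀ a, q.sizeUpTo a ≤ q.sizeUpTo j ↔ a ≤ j := by
    intro j a
    refine ⟨fun h => ?_, fun h => q.monotone_sizeUpTo h⟩
    by_contra! hlt
    exact absurd ((q.sizeUpTo_strict_mono j.2).trans_le (q.monotone_sizeUpTo hlt)) h.not_gt
  have hle : ∀ j : Fin q.length, ∀ a, q.sizeUpTo (j + 1) ≤ q.sizeUpTo a ↔ (j : ℕ) + 1 ≤ a := by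
    intro j a
    refine ⟨fun h => ?_, fun h => q.monotone_sizeUpTo h⟩
    by_contra! hlt
    exact absurd ((q.monotone_sizeUpTo (Nat.lt_succ_iff.1 hlt)).trans_lt
      (q.sizeUpTo_strict_mono j.2)) h.not_gt
  have hsucc : (ls.take (i + 1)).flatten.length =
      (ls.take i).flatten.length + ls[(i : ℕ)].length := by
    rw [List.take_succ_eq_append_getElem hi, List.flatten_append, List.length_append,
      List.flatten_singleton]
  have hbound : (ls.take (i + 1)).flatten.length ≤ q.length := by
    have : q.length = ((ls.take (i + 1)).flatten ++ (ls.drop (i + 1)).flatten).length := by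
      rw [← List.flatten_append, List.take_append_drop, hq]
    rw [this, List.length_append]
    omega
  simp only [Composition.runLength, Composition.sizeUpTo_of_runs hq hp, hlt, hle]
  rw [← Nat.add_sub_cancel_left (n := (ls.take i).flatten.length) (m := ls[(i : ℕ)].length),
    ← hsucc, ← Nat.card_Ico, ← Finset.card_map Fin.valEmbedding]
  congr 1
  ext k
  simp only [Finset.mem_map, Finset.mem_filter, Finset.mem_univ, true_and, Fin.valEmbedding_apply,
    Finset.mem_Ico]
  constructor
  · rintro ⟨j, ⟨h1, h2⟩, rfl⟩
    exact ⟨h1, h2⟩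
  · rintro ⟨h1, h2⟩
    exact ⟨⟨k, by omega⟩, ⟨h1, h2⟩, rfl⟩

theorem Composition.prod_runLength {n : ℕ} {q p : Composition n} {ls : List (List ℕ)}
    (hq : ls.flatten = q.blocks) (hp : ls.map List.sum = p.blocks) (F : ℕ → ℕ) :
    ∏ i : Fin p.length, F (q.runLength p i) = (ls.map fun l => F l.length).prod := by
  have hlen : p.length = ls.length := by
    rw [Composition.length, ← hp, List.length_map]
  rw [← List.prod_ofFn]
  congr 1
  refine List.ext_getElem (by simp [hlen]) fun i h1 h2 => ?_
  have hi : i < ls.length := by simpa using h2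
  simp [Composition.runLength_of_runs hq hp ⟨i, hlen ▸ hi⟩ hi]

/-! ### Refinements witnessed by explicit runs -/

namespace LSetComp

variable {n : ℕ} {L M : Type*}

/-- The blocks of `t`, grouped as `gs`, refine the blocks of `s`. -/
def IsRuns (s : LSetComp n L) (t : LSetComp n M) (gs : List (List (Finset (Fin n) × M))) : Prop :=
  gs.flatten = t.blocks ∧
    List.Forall₂ (fun a g => ∀ i, i ∈ a.1 ↔ ∃ b ∈ g, i ∈ b.1) s.blocks gs

/-- Refinement, with a condition `C` on the labels of each run. -/
def Refines (C : L → List L → Prop) (s t : LSetComp n L) : Prop := GroupsInto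
  (fun a g => (∀ i, i ∈ a.1 ↔ ∃ b ∈ g, i ∈ b.1) ∧ C a.2 (g.map Prod.snd)) s.blocks t.blocks

theorem le_iff_refines {s t : LSetComp n L} :
    s ≤ t ↔ Refines (fun a l => ∀ b ∈ l, b = a) s t := by
  simp only [Refines, List.forall_mem_map]
  rfl

theorem le_iff_isRuns {s t : LSetComp n L} :
    s ≤ t ↔ ∃ gs, IsRuns s t gs ∧
      List.Forall₂ (fun a g => ∀ b ∈ g, b.2 = a.2) s.blocks gs := by
  constructor
  · rintro ⟨gs, h1, h2⟩
    exact ⟨gs, ⟨h1, h2.imp fun _ _ h => h.1⟩, h2.imp fun _ _ h => h.2⟩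
  · rintro ⟨gs, ⟨h1, h2⟩, h3⟩
    exact ⟨gs, h1, h2.mp (fun _ _ h h' => ⟨h, h'⟩) h3⟩

theorem mulLE_iff_refines [CommMonoid L] {s t : LSetComp n L} :
    s.MulLE t ↔ Refines (fun a l => a = l.prod) s t := Iff.rfl

theorem sum_card_of_union {a : Finset (Fin n)} {g : List (Finset (Fin n) × M)}
    (h : ∀ i, i ∈ a ↔ ∃ b ∈ g, i ∈ b.1) (hg : g.Pairwise fun a b => Disjoint a.1 b.1) :
    a.card = (g.map fun b => b.1.card).sum := by
  rw [sum_card_aux g hg]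
  congr 1
  ext i
  simp [h]

namespace IsRuns

variable {s : LSetComp n L} {t : LSetComp n M} {gs : List (List (Finset (Fin n) × M))}

theorem mem_blocks (h : IsRuns s t gs) {g} (hg : g ∈ gs) {b} (hb : b ∈ g) : b ∈ t.blocks :=
  h.1 ▸ List.mem_flatten_of_mem hg hb

theorem pairwise (h : IsRuns s t gs) {g} (hg : g ∈ gs) :
    g.Pairwise fun a b => Disjoint a.1 b.1 := by
  have := t.disjoint
  rw [← h.1] at this
  exact (List.pairwise_flatten.1 this).1 g hg

theorem length_eq (h : IsRuns s t gs) : s.blocks.length = gs.length := h.2.length_eq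

theorem map_card (h : IsRuns s t gs) :
    s.blocks.map (fun a => a.1.card) = gs.map fun g => (g.map fun b => b.1.card).sum :=
  List.map_eq_map_of_forall₂ h.2 fun _ _ _ hg hr => sum_card_of_union hr (h.pairwise hg)

/-- `GroupsInto` allows empty runs; here they are excluded because the blocks of `s` are nonempty.
-/
theorem ne_nil (h : IsRuns s t gs) {g} (hg : g ∈ gs) : g ≠ [] := by
  rintro rfl
  have : ∃ a ∈ s.blocks, ∀ i, i ∈ a.1 ↔ ∃ b ∈ ([] : List (Finset (Fin n) × M)), i ∈ b.1 := by
    obtain ⟨k, hk, hkg⟩ := List.getElem_of_mem hg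
    have := (List.forall₂_iff_get.1 h.2).2 k (h.length_eq ▸ hk) hk
    simp only [List.get_eq_getElem, hkg] at this
    exact ⟨_, List.getElem_mem _, this⟩
  obtain ⟨a, ha, h'⟩ := this
  obtain ⟨i, hi⟩ := s.nonempty a ha
  simpa using (h' i).1 hi

/-- The cut of `t.blocks` is determined by the total size of each run, which is the size of the
corresponding coarser block. Allowing two different coarsenings makes the lemma usable for
coarsenings known only to share their type. -/
theorem eq_of_map_card {gs' : List (List (Finset (Fin n) × M))} {L' : Type*} {s' : LSetComp n L'}
    (h : IsRuns s t gs) (h' : IsRuns s' t gs')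
    (hs : s.blocks.map (fun a => a.1.card) = s'.blocks.map fun a => a.1.card) : gs = gs' := by
  refine List.eq_of_flatten_eq_of_sum_eq (fun b => b.1.card) (h.1.trans h'.1.symm) ?_ ?_
  · rw [h.1]
    exact fun b hb => Finset.card_pos.2 (t.nonempty b hb)
  · rw [← h.map_card, ← h'.map_card, hs]

theorem unique {gs' : List (List (Finset (Fin n) × M))}
    (h : IsRuns s t gs) (h' : IsRuns s t gs') : gs = gs' := h.eq_of_map_card h' rfl

theorem prod_runLength (h : IsRuns s t gs) (F : ℕ → ℕ) :
    ∏ i, F (t.type.abs.runLength s.type.abs i) = (gs.map fun g => F g.length).prod := by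
  rw [Composition.prod_runLength (ls := gs.map fun g => g.map fun b => b.1.card) _ _ F]
  · simp [Function.comp_def]
  · change _ = (t.blocks.map _).map _
    rw [← h.1, List.map_map, List.map_flatten]
    rfl
  · change _ = (s.blocks.map _).map _
    rw [List.map_map, List.map_map]
    exact h.map_card.symm

theorem relDeg_eq (h : IsRuns s t gs) : t.type.abs.relDeg s.type.abs = (gs.map List.length).prod :=
  h.prod_runLength id

theorem relDegFactorial_eq (h : IsRuns s t gs) : t.type.abs.relDegFactorial s.type.abs =
    (gs.map fun g => g.length.factorial).prod :=
  h.prod_runLength Nat.factorial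

theorem one_div_relDegFactorial (h : IsRuns s t gs) :
    1 / (t.type.abs.relDegFactorial s.type.abs : ℂ) =
      (gs.map fun g => 1 / (g.length.factorial : ℂ)).prod := by
  rw [h.relDegFactorial_eq]
  clear h
  induction gs with
  | nil => simp
  | cons g gs ih =>
    simp only [List.map_cons, List.prod_cons, ← ih]
    push_cast
    rw [one_div_mul_one_div]

theorem sign_div_relDeg (h : IsRuns s t gs) :
    (-1 : ℂ) ^ (t.length - s.length) / (t.type.abs.relDeg s.type.abs : ℂ) =
      (gs.map fun g => (-1 : ℂ) ^ (g.length - 1) / (g.length : ℂ)).prod := by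
  rw [h.relDeg_eq, LSetComp.length, LSetComp.length, ← h.1, h.length_eq]
  have hne : ∀ g ∈ gs, 1 ≤ g.length := fun g hg => List.length_pos_iff.2 (h.ne_nil hg)
  -- The inequality travels with the induction because the exponent splits over runs only if the
  -- natural subtraction is not truncated.
  have hlen : gs.length ≤ gs.flatten.length ∧ (-1 : ℂ) ^ (gs.flatten.length - gs.length) =
      (gs.map fun g => (-1 : ℂ) ^ (g.length - 1)).prod := by
    clear h
    induction gs with
    | nil => simp
    | cons g gs ih =>
      obtain ⟨ih1, ih2⟩ := ih fun g hg => hne g (by simp [hg])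
      have := hne g (by simp)
      simp only [List.flatten_cons, List.length_append, List.length_cons, List.map_cons,
        List.prod_cons, ← ih2, ← pow_add]
      refine ⟨by omega, ?_⟩
      congr 1
      omega
  rw [hlen.2]
  clear h hne hlen
  induction gs with
  | nil => simp
  | cons g gs ih =>
    simp only [List.map_cons, List.prod_cons, ← ih]
    push_cast
    rw [mul_div_mul_comm]

end IsRuns

/-- The coarsening of `t` obtained by merging the runs `ks`, given the list of blocks. -/
def coarsen (t : LSetComp n M) (bs : List (Finset (Fin n) × L))
    (ks : List (List (Finset (Fin n) × M))) (hflat : ks.flatten = t.blocks)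
    (hne : ∀ k ∈ ks, k ≠ [])
    (hbs : List.Forall₂ (fun a g => ∀ i, i ∈ a.1 ↔ ∃ b ∈ g, i ∈ b.1) bs ks) : LSetComp n L where
  blocks := bs
  nonempty := by
    intro a ha
    obtain ⟨k, hk, rfl⟩ := List.getElem_of_mem ha
    have hk' : k < ks.length := hbs.length_eq ▸ hk
    have := (List.forall₂_iff_get.1 hbs).2 k hk hk'
    obtain ⟨b, hb⟩ := List.exists_mem_of_ne_nil _ (hne ks[k] (List.getElem_mem _))
    obtain ⟨i, hi⟩ := t.nonempty b (hflat ▸ List.mem_flatten_of_mem (List.getElem_mem hk') hb)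
    exact ⟨i, (this i).2 ⟨b, hb, hi⟩⟩
  disjoint := by
    have hd := t.disjoint
    rw [← hflat] at hd
    have hd := (List.pairwise_flatten.1 hd).2
    rw [List.pairwise_iff_getElem] at hd ⊢
    intro i j hi hj hij
    have hi' : i < ks.length := hbs.length_eq ▸ hi
    have hj' : j < ks.length := hbs.length_eq ▸ hj
    rw [Finset.disjoint_left]
    intro x hx hx'
    obtain ⟨b, hb, hxb⟩ := ((List.forall₂_iff_get.1 hbs).2 i hi hi' x).1 hx
    obtain ⟨c, hc, hxc⟩ := ((List.forall₂_iff_get.1 hbs).2 j hj hj' x).1 hx'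
    exact Finset.disjoint_left.1 (hd i j hi' hj' hij b hb c hc) hxb hxc
  cover := by
    intro x
    obtain ⟨b, hb, hx⟩ := t.cover x
    rw [← hflat] at hb
    obtain ⟨g, hg, hb⟩ := List.mem_flatten.1 hb
    obtain ⟨k, hk, rfl⟩ := List.getElem_of_mem hg
    have hk' : k < bs.length := hbs.length_eq ▸ hk
    exact ⟨bs[k], List.getElem_mem _, ((List.forall₂_iff_get.1 hbs).2 k hk' hk x).2 ⟨b, hb, hx⟩⟩

end LSetComp

/-! ### Refinement and types -/

namespace LIntComp

variable {n : ℕ} {L : Type*}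

/-- Refinement, with a condition `C` on the labels of each run. -/
def Refines (C : L → List L → Prop) (p q : LIntComp n L) : Prop := GroupsInto
  (fun a g => a.1 = (g.map Prod.fst).sum ∧ C a.2 (g.map Prod.snd)) p.blocks q.blocks

theorem le_iff_refines {p q : LIntComp n L} :
    p ≤ q ↔ Refines (fun a l => ∀ b ∈ l, b = a) p q := by
  simp only [Refines, List.forall_mem_map]
  rfl

theorem mulLE_iff_refines [CommMonoid L] {p q : LIntComp n L} :
    p.MulLE q ↔ Refines (fun a l => a = l.prod) p q := Iff.rfl

end LIntComp

namespace LSetComp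

variable {n : ℕ} {L M : Type*} {C : L → List L → Prop}

theorem refines_iff_isRuns {s t : LSetComp n L} :
    Refines C s t ↔ ∃ gs, IsRuns s t gs ∧
      List.Forall₂ (fun a g => C a.2 (g.map Prod.snd)) s.blocks gs := by
  constructor
  · rintro ⟨gs, h1, h2⟩
    exact ⟨gs, ⟨h1, h2.imp fun _ _ h => h.1⟩, h2.imp fun _ _ h => h.2⟩
  · rintro ⟨gs, ⟨h1, h2⟩, h3⟩
    exact ⟨gs, h1, h2.mp (fun _ _ h h' => ⟨h, h'⟩) h3⟩

theorem Refines.type {s t : LSetComp n L} (h : Refines C s t) :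
    LIntComp.Refines C s.type t.type := by
  obtain ⟨gs, h1, h2⟩ := refines_iff_isRuns.1 h
  refine ⟨gs.map (List.map fun b => (b.1.card, b.2)), ?_, ?_⟩
  · rw [← List.map_flatten, h1.1]
    rfl
  · change List.Forall₂ _ (s.blocks.map _) _
    rw [List.forall₂_map_left_iff, List.forall₂_map_right_iff]
    have hr := h1.map_card
    rw [← List.forall₂_eq_eq_eq, List.forall₂_map_left_iff, List.forall₂_map_right_iff] at hr
    refine hr.mp (fun a g hr hC => ⟨?_, ?_⟩) h2
    · simpa [Function.comp_def] using hr
    · simpa [Function.comp_def] using hC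

/-- The type fixes the block sizes, the sizes fix the runs of `t`, and the blocks are the unions of
these runs; the labels are part of the type. -/
theorem Refines.eq_of_type_eq {s s' t : LSetComp n L} (h : Refines C s t) (h' : Refines C s' t)
    (hs : s.type = s'.type) : s = s' := by
  obtain ⟨gs, h1, -⟩ := refines_iff_isRuns.1 h
  obtain ⟨gs', h1', -⟩ := refines_iff_isRuns.1 h'
  have hb : s.blocks.map (fun b => (b.1.card, b.2)) = s'.blocks.map fun b => (b.1.card, b.2) :=
    congrArg LIntComp.blocks hs
  obtain rfl : gs = gs' := h1.eq_of_map_card h1' (by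
    simpa [Function.comp_def] using congrArg (List.map Prod.fst) hb)
  apply LSetComp.ext
  have hl : s.blocks.map Prod.snd = s'.blocks.map Prod.snd := by
    simpa [Function.comp_def] using congrArg (List.map Prod.snd) hb
  have hf : s.blocks.map Prod.fst = s'.blocks.map Prod.fst := by
    have e1 := List.map_eq_map_of_forall₂ (f := Prod.fst)
      (g := fun g : List (Finset (Fin n) × L) => Finset.univ.filter fun i => ∃ b ∈ g, i ∈ b.1)
      h1.2 fun a g _ _ hr => by ext i; simp [hr i]
    have e2 := List.map_eq_map_of_forall₂ (f := Prod.fst)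
      (g := fun g : List (Finset (Fin n) × L) => Finset.univ.filter fun i => ∃ b ∈ g, i ∈ b.1)
      h1'.2 fun a g _ _ hr => by ext i; simp [hr i]
    rw [e1, e2]
  rw [← List.zip_unzip s.blocks, ← List.zip_unzip s'.blocks]
  simp only [List.unzip_eq_map, hl, hf]

/-- The union of the blocks in a list. -/
def union (g : List (Finset (Fin n) × M)) : Finset (Fin n) :=
  Finset.univ.filter fun i => ∃ b ∈ g, i ∈ b.1

@[simp]
theorem mem_union {g : List (Finset (Fin n) × M)} {i : Fin n} :
    i ∈ union g ↔ ∃ b ∈ g, i ∈ b.1 := by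
  simp [union]

/-- Cut `t.blocks` where the list of sizes is cut, take the union of each run, and label it as in
`p`. -/
theorem exists_refines_of_type {p : LIntComp n L} {t : LSetComp n L}
    (h : LIntComp.Refines C p t.type) : ∃ s : LSetComp n L, Refines C s t ∧ s.type = p := by
  obtain ⟨hs, h1, h2⟩ := h
  have hr : List.Forall₂ (fun c (b : Finset (Fin n) × L) => c = (b.1.card, b.2))
      hs.flatten t.blocks := by
    rw [h1, ← List.forall₂_map_right_iff, List.forall₂_eq_eq_eq]
    rfl
  obtain ⟨ks, hk, hks⟩ := List.exists_flatten_of_forall₂ hr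
  obtain rfl : hs = ks.map (List.map fun b => (b.1.card, b.2)) := by
    rw [← List.forall₂_eq_eq_eq, List.forall₂_map_right_iff]
    refine hks.imp fun a b hab => ?_
    rw [← List.forall₂_eq_eq_eq, List.forall₂_map_right_iff]
    exact hab
  rw [List.forall₂_map_right_iff] at h2
  have hd := t.disjoint
  rw [← hk] at hd
  have hcard : ∀ k ∈ ks, (union k).card = (k.map fun b => b.1.card).sum := fun k hk' =>
    sum_card_of_union (fun i => mem_union) ((List.pairwise_flatten.1 hd).1 k hk')
  have hne : ∀ k ∈ ks, k ≠ [] := by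
    rintro k hk' rfl
    have hlen := h2.length_eq
    obtain ⟨j, hj, hjk⟩ := List.getElem_of_mem hk'
    have := (List.forall₂_iff_get.1 h2).2 j (hlen ▸ hj) hj
    have hpos := p.pos _ (List.get_mem p.blocks ⟨j, hlen ▸ hj⟩)
    simp only [List.get_eq_getElem, hjk] at this hpos
    simp [this.1] at hpos
  have hbs : List.Forall₂ (fun a g => ∀ i, i ∈ a.1 ↔ ∃ b ∈ g, i ∈ b.1)
      (List.zipWith (fun (a : ℕ × L) (k : List (Finset (Fin n) × L)) => (union k, a.2))
        p.blocks ks) ks := by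
    clear hr hk hks hd hcard hne h1
    generalize p.blocks = bs at h2
    induction h2 with
    | nil => exact .nil
    | cons _ _ ih => exact .cons (fun i => mem_union) ih
  refine ⟨coarsen t _ ks hk hne hbs, ⟨ks, hk, hbs.mp (fun _ _ h h' => ⟨h, h'⟩) ?_⟩, ?_⟩
  · clear hr hk hks hd hcard hne h1 hbs
    generalize p.blocks = bs at h2
    induction h2 with
    | nil => exact .nil
    | cons h _ ih => exact .cons (by simpa [Function.comp_def] using h.2) ih
  · apply LIntComp.ext
    change (List.zipWith _ _ _).map _ = _
    clear hr hk hks hd hne h1 hbs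
    generalize p.blocks = bs at h2
    induction h2 with
    | nil => rfl
    | cons h _ ih =>
      simp only [List.zipWith_cons_cons, List.map_cons, List.cons.injEq]
      refine ⟨?_, ih fun k hk => hcard k (by simp [hk])⟩
      rw [hcard _ (by simp)]
      exact Prod.ext (by simpa [Function.comp_def] using h.1.symm) rfl

/-- Sums over all refinements of all `s` of a given type, with coefficients depending on types
only, regrouped by the type of the refinement. -/
theorem sum_type_sum_refines [Finite L] {A : Type*} [AddCommGroup A] [Module ℂ A]
    (c : LIntComp n L → LIntComp n L → ℂ) (F : LSetComp n L → A) (p : LIntComp n L) :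
    ∑ s : LSetComp n L with s.type = p, ∑ t : LSetComp n L with Refines C s t,
        c s.type t.type • F t =
      ∑ q : LIntComp n L with LIntComp.Refines C p q,
        c p q • ∑ t : LSetComp n L with t.type = q, F t := by
  simp only [Finset.smul_sum]
  -- Both double sums become sums over the `t` whose type refines `p`. The inner index is then
  -- unique on either side: a single `s` of type `p` is refined by `t`, and `q` must be `t.type`.
  rw [Finset.sum_comm' (s' := fun t => Finset.univ.filter fun s => s.type = p ∧ Refines C s t)
      (t' := Finset.univ.filter fun t : LSetComp n L => LIntComp.Refines C p t.type),
    Finset.sum_comm' (s' := fun t => {t.type})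
      (t' := Finset.univ.filter fun t : LSetComp n L => LIntComp.Refines C p t.type)]
  · refine Finset.sum_congr rfl fun t ht => ?_
    obtain ⟨s, hs, rfl⟩ := exists_refines_of_type (Finset.mem_filter.1 ht).2
    rw [Finset.sum_singleton, Finset.sum_eq_single_of_mem s (by simp [hs])]
    intro s' hs' hne
    rw [Finset.mem_filter] at hs'
    exact absurd (hs'.2.2.eq_of_type_eq hs hs'.2.1) hne
  · intro q t
    simp only [Finset.mem_filter, Finset.mem_univ, true_and, Finset.mem_singleton]
    constructor
    · rintro ⟨h, rfl⟩
      exact ⟨rfl, h⟩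
    · rintro ⟨rfl, h⟩
      exact ⟨h, rfl⟩
  · intro s t
    simp only [Finset.mem_filter, Finset.mem_univ, true_and]
    constructor
    · rintro ⟨rfl, h⟩
      exact ⟨⟨rfl, h⟩, h.type⟩
    · rintro ⟨h, -⟩
      exact h

end LSetComp

/-! ### Splitting lists into runs -/

section Splits

variable {B : Type*}

/-- The lists `xs` related entrywise to `l` by membership in `F`. -/
noncomputable def listPi {A B : Type*} (F : A → Finset B) : List A → Finset (List B)
  | [] => {[]}
  | a :: l => (F a ×ˢ listPi F l).image fun x => x.1 :: x.2

theorem mem_listPi {A B : Type*} {F : A → Finset B} {l : List A} {xs : List B} :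
    xs ∈ listPi F l ↔ List.Forall₂ (fun a x => x ∈ F a) l xs := by
  induction l generalizing xs with
  | nil => simp [listPi]
  | cons a l ih =>
    simp only [listPi, Finset.mem_image, Finset.mem_product, List.forall₂_cons_left_iff, ih]
    constructor
    · rintro ⟨⟨x, ys⟩, ⟨h1, h2⟩, rfl⟩
      exact ⟨x, ys, h1, h2, rfl⟩
    · rintro ⟨x, ys, h1, h2, rfl⟩
      exact ⟨(x, ys), ⟨h1, h2⟩, rfl⟩

theorem sum_listPi {A B R : Type*} [CommSemiring R] (F : A → Finset B) (f : B → R) (l : List A) :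
    ∑ xs ∈ listPi F l, (xs.map f).prod = (l.map fun a => ∑ x ∈ F a, f x).prod := by
  induction l with
  | nil => simp [listPi]
  | cons a l ih =>
    rw [listPi, Finset.sum_image, List.map_cons, List.prod_cons, ← ih, Finset.sum_mul_sum,
      Finset.sum_product]
    · simp
    · rintro ⟨x, ys⟩ - ⟨x', ys'⟩ - h
      simpa using h

/-- The ways to cut `l` into `j` nonempty consecutive lists. -/
noncomputable def splitsOfLength : ℕ → List B → Finset (List (List B))
  | 0, l => if l = [] then {[]} else ∅
  -- The first piece has length `i + 1`, so it is never empty.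
  | j + 1, l => (Finset.range l.length).biUnion fun i =>
      (splitsOfLength j (l.drop (i + 1))).image fun ks => l.take (i + 1) :: ks

theorem mem_splitsOfLength {j : ℕ} {l : List B} {ks : List (List B)} :
    ks ∈ splitsOfLength j l ↔ ks.flatten = l ∧ (∀ k ∈ ks, k ≠ []) ∧ ks.length = j := by
  induction j generalizing l ks with
  | zero =>
    rw [splitsOfLength]
    split_ifs with h
    · subst h
      simp only [Finset.mem_singleton, List.length_eq_zero_iff]
      constructor
      · rintro rfl
        simp
      · exact fun h => h.2.2
    · simp only [Finset.notMem_empty, List.length_eq_zero_iff, false_iff]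
      rintro ⟨rfl, -, rfl⟩
      exact h rfl
  | succ j ih =>
    simp only [splitsOfLength, Finset.mem_biUnion, Finset.mem_range, Finset.mem_image, ih]
    constructor
    · rintro ⟨i, hi, ks, ⟨h1, h2, h3⟩, rfl⟩
      refine ⟨by simp [h1], ?_, by simp [h3]⟩
      rintro k hk
      rcases List.mem_cons.1 hk with rfl | hk
      · rw [← List.length_pos_iff, List.length_take]
        omega
      · exact h2 k hk
    · rintro ⟨rfl, h2, h3⟩
      rcases ks with _ | ⟨k, ks⟩
      · simp at h3
      · have hk : 0 < k.length := List.length_pos_iff.2 (h2 k (by simp))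
        have hk1 : k.length - 1 + 1 = k.length := by omega
        refine ⟨k.length - 1, ?_, ks, ⟨?_, fun k' hk' => h2 k' (by simp [hk']), by simpa using h3⟩,
          ?_⟩
        · simp only [List.flatten_cons, List.length_append]
          omega
        · rw [hk1, List.flatten_cons, List.drop_left]
        · rw [hk1, List.flatten_cons, List.take_left]

/-- The ways to cut `l` into nonempty consecutive lists. -/
noncomputable def splits (l : List B) : Finset (List (List B)) :=
  (Finset.range (l.length + 1)).biUnion fun j => splitsOfLength j l

theorem length_le_length_flatten {ks : List (List B)} (h : ∀ k ∈ ks, k ≠ []) :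
    ks.length ≤ ks.flatten.length := by
  induction ks with
  | nil => simp
  | cons k ks ih =>
    have := ih fun k' hk' => h k' (by simp [hk'])
    have hk : 0 < k.length := List.length_pos_iff.2 (h k (by simp))
    simp only [List.flatten_cons, List.length_append, List.length_cons]
    omega

theorem mem_splits {l : List B} {ks : List (List B)} :
    ks ∈ splits l ↔ ks.flatten = l ∧ ∀ k ∈ ks, k ≠ [] := by
  simp only [splits, Finset.mem_biUnion, Finset.mem_range, mem_splitsOfLength]
  constructor
  · rintro ⟨j, -, h1, h2, -⟩
    exact ⟨h1, h2⟩
  · rintro ⟨rfl, h2⟩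
    exact ⟨ks.length, Nat.lt_succ_of_le (length_le_length_flatten h2), rfl, h2, rfl⟩

open PowerSeries in
-- `exp - 1` is the exponential generating function of nonempty runs, and splitting off the first
-- piece is the Cauchy product with one more factor.
theorem sum_splitsOfLength (j : ℕ) (l : List B) :
    ∑ ks ∈ splitsOfLength j l, (ks.map fun k => 1 / (k.length.factorial : ℂ)).prod =
      coeff l.length ((exp ℂ - 1) ^ j) := by
  induction j generalizing l with
  | zero =>
    rw [splitsOfLength, pow_zero, coeff_one]
    simp only [List.length_eq_zero_iff]
    split_ifs with h <;> simp
  | succ j ih =>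
    rw [splitsOfLength, Finset.sum_biUnion, pow_succ', coeff_mul,
      Finset.Nat.sum_antidiagonal_eq_sum_range_succ
        (fun a b => coeff a (exp ℂ - 1) * coeff b ((exp ℂ - 1) ^ j)), Finset.sum_range_succ']
    · have h0 : coeff 0 (exp ℂ - 1) = (0 : ℂ) := by simp
      rw [h0, zero_mul, add_zero]
      refine Finset.sum_congr rfl fun i hi => ?_
      rw [Finset.sum_image (by intro a _ b _ h; simpa using h)]
      simp only [List.map_cons, List.prod_cons, ← Finset.mul_sum, ih, List.length_drop]
      congr 1
      rw [List.length_take, min_eq_left (Finset.mem_range.1 hi), map_sub, coeff_exp, coeff_one]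
      simp
    · intro i hi i' hi' hne
      rw [Function.onFun, Finset.disjoint_left]
      intro ks h h'
      obtain ⟨ks, -, rfl⟩ := Finset.mem_image.1 h
      obtain ⟨ks', -, h'⟩ := Finset.mem_image.1 h'
      have := congrArg List.length (List.cons.inj h').1
      rw [List.length_take, List.length_take] at this
      have h1 : i < l.length := by simpa using hi
      have h2 : i' < l.length := by simpa using hi'
      omega

open PowerSeries in
/-- The coefficients of `log (exp x) = x`. -/
theorem sum_coeff_log_exp (m : ℕ) :
    ∑ j ∈ Finset.range (m + 2), (-1 : ℂ) ^ (j - 1) / j * coeff (m + 1) ((exp ℂ - 1) ^ j) =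
      if m = 0 then 1 else 0 := by
  have hd : derivative ℂ (exp ℂ - 1) = (exp ℂ - 1) + 1 := by
    rw [map_sub, derivative_exp]
    simp
  -- This kills the far end of the telescoping sum below.
  have hX : coeff m ((exp ℂ - 1) ^ (m + 1)) = (0 : ℂ) := by
    have h : (X : PowerSeries ℂ) ∣ exp ℂ - 1 := X_dvd_iff.2 (by simp)
    exact X_pow_dvd_iff.1 (pow_dvd_pow_of_dvd h (m + 1)) m (Nat.lt_succ_self m)
  set f : PowerSeries ℂ := exp ℂ - 1
  have hm : (m : ℂ) + 1 ≠ 0 := Nat.cast_add_one_ne_zero m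
  -- With `f' = f + 1`, the coefficient of `x^m` in `(f^(j+1))' = (j+1) (f^(j+1) + f^j)` writes each
  -- term as a difference, so the sum telescopes.
  have hterm : ∀ j : ℕ, (-1 : ℂ) ^ (j + 1 - 1) / (j + 1 : ℕ) * coeff (m + 1) (f ^ (j + 1)) =
      ((-1 : ℂ) ^ j * coeff m (f ^ j) - (-1 : ℂ) ^ (j + 1) * coeff m (f ^ (j + 1))) / (m + 1) := by
    intro j
    have h := coeff_derivative (f ^ (j + 1)) m
    rw [derivative_pow, hd] at h
    have hj : (j : ℂ) + 1 ≠ 0 := Nat.cast_add_one_ne_zero j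
    have h2 : ((j : ℂ) + 1) * (coeff m (f ^ (j + 1)) + coeff m (f ^ j)) =
        coeff (m + 1) (f ^ (j + 1)) * (m + 1) := by
      rw [← h, ← map_add, Nat.add_sub_cancel]
      have : ((j + 1 : ℕ) : PowerSeries ℂ) * f ^ j * (f + 1) =
          C ((j : ℂ) + 1) * (f ^ (j + 1) + f ^ j) := by
        push_cast
        simp only [map_add, map_natCast, map_one]
        ring
      rw [this, coeff_C_mul]
    rw [Nat.add_sub_cancel, pow_succ (-1 : ℂ) j]
    push_cast
    rw [eq_div_iff hm, mul_assoc, ← h2]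
    field_simp
    ring
  -- The term `j = 0` is split off; it vanishes because division by `0` yields `0`.
  rw [Finset.sum_range_succ']
  simp only [hterm]
  rw [← Finset.sum_div, Finset.sum_range_sub' (fun j => (-1 : ℂ) ^ j * coeff m (f ^ j)), hX]
  simp only [coeff_one, pow_zero, one_mul, mul_zero, sub_zero, Nat.cast_zero, div_zero, zero_mul,
    add_zero]
  split_ifs with h <;> simp [h]

/-- Grouping the cuts by their number `j` of pieces produces the coefficient of `log (1 + (exp x -
1))` in degree `l.length`. -/
theorem sum_splits {l : List B} (hl : l ≠ []) :
    ∑ ks ∈ splits l, (-1 : ℂ) ^ (ks.length - 1) / (ks.length : ℂ) *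
        (ks.map fun k => 1 / (k.length.factorial : ℂ)).prod =
      if l.length = 1 then 1 else 0 := by
  obtain ⟨m, hm⟩ : ∃ m, l.length = m + 1 :=
    ⟨l.length - 1, by have := List.length_pos_iff.2 hl; omega⟩
  rw [splits, Finset.sum_biUnion]
  · have h := sum_coeff_log_exp m
    simp only [hm, Nat.add_eq_right]
    rw [← h]
    refine Finset.sum_congr rfl fun j _ => ?_
    rw [← hm, ← sum_splitsOfLength, Finset.mul_sum]
    refine Finset.sum_congr rfl fun ks hks => ?_
    rw [(mem_splitsOfLength.1 hks).2.2]
  · intro i _ i' _ hne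
    rw [Function.onFun, Finset.disjoint_left]
    intro ks h h'
    exact hne ((mem_splitsOfLength.1 h).2.2.symm.trans (mem_splitsOfLength.1 h').2.2)

end Splits

/-! ### Inversion -/

namespace LSetComp

variable {n : ℕ} {L : Type*}

/-- A run determines its block as a union, and its label because the run is nonempty and all its
labels agree with it. -/
theorem eq_of_isRuns {t t' r : LSetComp n L} {ks : List (List (Finset (Fin n) × L))}
    (h : IsRuns t r ks) (hl : List.Forall₂ (fun a g => ∀ b ∈ g, b.2 = a.2) t.blocks ks)
    (h' : IsRuns t' r ks) (hl' : List.Forall₂ (fun a g => ∀ b ∈ g, b.2 = a.2) t'.blocks ks) :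
    t = t' := by
  apply LSetComp.ext
  have hne : ∀ k ∈ ks, k ≠ [] := fun k hk => h.ne_nil hk
  replace h := h.2
  replace h' := h'.2
  generalize t.blocks = l at *
  generalize t'.blocks = l' at *
  induction ks generalizing l l' with
  | nil =>
    cases h
    cases h'
    rfl
  | cons k ks ih =>
    rcases h with _ | ⟨h, hs⟩
    rcases h' with _ | ⟨h', hs'⟩
    rcases hl with _ | ⟨hl, hls⟩
    rcases hl' with _ | ⟨hl', hls'⟩
    rw [ih (fun k hk => hne k (List.mem_cons_of_mem _ hk)) _ hls hs _ hls' hs']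
    congr 1
    refine Prod.ext (Finset.ext fun i => (h i).trans (h' i).symm) ?_
    obtain ⟨b, hb⟩ := List.exists_mem_of_ne_nil _ (hne k (by simp))
    exact (hl b hb).symm.trans (hl' b hb)

/-- The runs in a chain `s ≤ t ≤ r`. -/
theorem exists_runs_of_chain {s t r : LSetComp n L} (hst : s ≤ t) (htr : t ≤ r) :
    ∃ hs Ks, IsRuns s t hs ∧ List.Forall₂ (fun h K => h.length = K.length) hs Ks ∧
      IsRuns t r Ks.flatten ∧
      List.Forall₂ (fun a g => ∀ b ∈ g, b.2 = a.2) t.blocks Ks.flatten ∧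
      IsRuns s r (Ks.map List.flatten) ∧
      List.Forall₂ (fun a g => ∀ b ∈ g, b.2 = a.2) s.blocks (Ks.map List.flatten) := by
  obtain ⟨hs, h1, h2⟩ := le_iff_isRuns.1 hst
  obtain ⟨ks, h3, h4⟩ := le_iff_isRuns.1 htr
  have h34 := h3.2.mp (fun a g h h' => And.intro h h') h4
  rw [← h1.1] at h34
  -- `Ks` groups the runs of `t ≤ r` according to the run of `s ≤ t` containing their block;
  -- flattening each group yields the runs of `s ≤ r`.
  obtain ⟨Ks, rfl, hK⟩ := List.exists_flatten_of_forall₂ h34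
  refine ⟨hs, Ks, h1, hK.imp fun _ _ h => h.length_eq, h3, h4, ⟨?_, ?_⟩, ?_⟩
  · rw [← h3.1, List.flatten_flatten]
  all_goals
    rw [List.forall₂_map_right_iff]
    replace h1 := h1.2
    clear h3 h4 h34
    generalize s.blocks = l at *
    induction hK generalizing l with
    | nil => cases h1; exact .nil
    | @cons h K hs Ks hr _ ih =>
      rcases h1 with _ | ⟨h1, hs1⟩
      rcases h2 with _ | ⟨h2, hs2⟩
      refine .cons ?_ (ih _ hs2 hs1)
      clear hs1 hs2 ih
      try intro i
      simp only [List.mem_flatten]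
      first
      | rw [h1]
        constructor
        · rintro ⟨b, hb, hi⟩
          obtain ⟨j, hj, rfl⟩ := List.getElem_of_mem hb
          obtain ⟨c, hc, hi⟩ := (((List.forall₂_iff_get.1 hr).2 j hj
            (hr.length_eq ▸ hj)).1 i).1 hi
          exact ⟨c, ⟨_, List.get_mem _ _, hc⟩, hi⟩
        · rintro ⟨c, ⟨k, hk, hc⟩, hi⟩
          obtain ⟨j, hj, rfl⟩ := List.getElem_of_mem hk
          have hj' : j < h.length := hr.length_eq ▸ hj
          exact ⟨_, List.get_mem _ _, (((List.forall₂_iff_get.1 hr).2 j hj' hj).1 i).2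
            ⟨c, hc, hi⟩⟩
      | rintro ⟨k, hk, hc⟩
        obtain ⟨j, hj, rfl⟩ := List.getElem_of_mem hk
        have hj' : j < h.length := hr.length_eq ▸ hj
        exact (((List.forall₂_iff_get.1 hr).2 j hj' hj).2 i hc).trans
          (h2 _ (List.get_mem h ⟨j, hj'⟩))

theorem le_trans' {s t r : LSetComp n L} (hst : s ≤ t) (htr : t ≤ r) : s ≤ r := by
  obtain ⟨_, Ks, -, -, -, -, h, h'⟩ := exists_runs_of_chain hst htr
  exact le_iff_isRuns.2 ⟨_, h, h'⟩

theorem isRuns_refl (s : LSetComp n L) : IsRuns s s (s.blocks.map fun b => [b]) := by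
  refine ⟨by simp [← List.flatMap_def], ?_⟩
  rw [List.forall₂_map_right_iff, List.forall₂_same]
  simp

theorem le_refl' (s : LSetComp n L) : s ≤ s := by
  refine le_iff_isRuns.2 ⟨_, isRuns_refl s, ?_⟩
  rw [List.forall₂_map_right_iff, List.forall₂_same]
  simp

theorem eq_iff_runs_singleton {s r : LSetComp n L} {gs : List (List (Finset (Fin n) × L))}
    (h : IsRuns s r gs) (hl : List.Forall₂ (fun a g => ∀ b ∈ g, b.2 = a.2) s.blocks gs) :
    s = r ↔ ∀ g ∈ gs, g.length = 1 := by
  constructor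
  · rintro rfl
    rw [h.unique (isRuns_refl s)]
    exact List.forall_mem_map.2 fun _ _ => rfl
  · intro h1
    obtain ⟨bs, rfl⟩ : ∃ bs : List (Finset (Fin n) × L), gs = bs.map fun b => [b] := by
      clear h hl
      induction gs with
      | nil => exact ⟨[], rfl⟩
      | cons g gs ih =>
        obtain ⟨bs, rfl⟩ := ih fun g hg => h1 g (by simp [hg])
        obtain ⟨b, rfl⟩ := List.length_eq_one_iff.1 (h1 g (by simp))
        exact ⟨b :: bs, rfl⟩
    have hr : r.blocks = bs := by
      rw [← h.1]
      simp [← List.flatMap_def]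
    subst hr
    refine eq_of_isRuns h hl (isRuns_refl r) ?_
    rw [List.forall₂_map_right_iff, List.forall₂_same]
    simp

/-- Given `s ≤ r` with runs `gs`, splitting each run gives some `t` between `s` and `r`. -/
theorem exists_between {s r : LSetComp n L} {gs : List (List (Finset (Fin n) × L))}
    (h : IsRuns s r gs) (hl : List.Forall₂ (fun a g => ∀ b ∈ g, b.2 = a.2) s.blocks gs)
    {Ks : List (List (List (Finset (Fin n) × L)))} (hK : Ks ∈ listPi splits gs) :
    ∃ t : LSetComp n L, ∃ hs, s ≤ t ∧ t ≤ r ∧ IsRuns s t hs ∧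
      List.Forall₂ (fun h K => h.length = K.length) hs Ks ∧ IsRuns t r Ks.flatten := by
  have hK' := mem_listPi.1 hK
  simp only [mem_splits] at hK'
  obtain rfl : gs = Ks.map List.flatten := by
    rw [← List.forall₂_eq_eq_eq, List.forall₂_map_right_iff]
    exact hK'.imp fun a K h => h.1.symm
  rw [List.forall₂_map_left_iff, List.forall₂_same] at hK'
  rw [List.forall₂_map_right_iff] at hl
  have hflat : Ks.flatten.flatten = r.blocks := by rw [← h.1, List.flatten_flatten]
  have hne : ∀ k ∈ Ks.flatten, k ≠ [] := by
    intro k hk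
    obtain ⟨K, hK, hk⟩ := List.mem_flatten.1 hk
    exact (hK' K hK).2 k hk
  have hu := h.2
  rw [List.forall₂_map_right_iff] at hu
  obtain ⟨hs, hs1, hs2⟩ : ∃ hs : List (List (Finset (Fin n) × L)),
      List.Forall₂ (fun a g => (∀ i, i ∈ a.1 ↔ ∃ b ∈ g, i ∈ b.1) ∧ ∀ b ∈ g, b.2 = a.2)
        s.blocks hs ∧
      List.Forall₂ (List.Forall₂ fun a g => (∀ i, i ∈ a.1 ↔ ∃ b ∈ g, i ∈ b.1) ∧
        ∀ b ∈ g, b.2 = a.2) hs Ks := by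
    clear h hK hK' hflat hne
    generalize s.blocks = l at *
    induction hu with
    | nil => exact ⟨[], .nil, .nil⟩
    | @cons a K l Ks hr _ ih =>
      rcases hl with _ | ⟨hl, hls⟩
      obtain ⟨hs, h1, h2⟩ := ih hls
      refine ⟨(K.map fun k => (union k, a.2)) :: hs, .cons ⟨fun i => ?_, ?_⟩ h1, .cons ?_ h2⟩
      · rw [hr]
        simp only [List.mem_flatten, List.mem_map]
        constructor
        · rintro ⟨b, ⟨k, hk, hb⟩, hi⟩
          exact ⟨_, ⟨k, hk, rfl⟩, mem_union.2 ⟨b, hb, hi⟩⟩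
        · rintro ⟨_, ⟨k, hk, rfl⟩, hi⟩
          obtain ⟨b, hb, hi⟩ := mem_union.1 hi
          exact ⟨b, ⟨k, hk, hb⟩, hi⟩
      · simp
      · rw [List.forall₂_map_left_iff, List.forall₂_same]
        exact fun k hk => ⟨fun i => mem_union, fun b hb => hl b (List.mem_flatten_of_mem hk hb)⟩
  have hf := List.rel_flatten hs2
  let t := coarsen r hs.flatten Ks.flatten hflat hne (hf.imp fun _ _ h => h.1)
  have ht1 : IsRuns s t hs := ⟨rfl, hs1.imp fun _ _ h => h.1⟩
  have ht2 : IsRuns t r Ks.flatten := ⟨hflat, hf.imp fun _ _ h => h.1⟩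
  exact ⟨t, hs, le_iff_isRuns.2 ⟨_, ht1, hs1.imp fun _ _ h => h.2⟩,
    le_iff_isRuns.2 ⟨_, ht2, hf.imp fun _ _ h => h.2⟩, ht1, hs2.imp fun _ _ h => h.length_eq, ht2⟩

theorem prod_map_flatten {B R : Type*} [CommMonoid R] (f : B → R) (Ks : List (List B)) :
    (Ks.flatten.map f).prod = (Ks.map fun K => (K.map f).prod).prod := by
  induction Ks with
  | nil => simp
  | cons K Ks ih => simp only [List.flatten_cons, List.map_append, List.prod_append, ih, List.map_cons,
      List.prod_cons]

/-- The `t` between `s` and `r` correspond to independent cuts of the runs of `s ≤ r`, so the sum is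
a product over runs of the sums in `sum_splits`. The product is `1` if every run is a singleton,
that is `s = r`, and `0` otherwise. -/
theorem sum_between [Finite L] (s r : LSetComp n L) :
    ∑ t : LSetComp n L with s ≤ t ∧ t ≤ r,
        (-1 : ℂ) ^ (t.length - s.length) / (t.relDeg s : ℂ) * (1 / (r.relDegFactorial t : ℂ)) =
      if s = r then 1 else 0 := by
  by_cases hsr : s ≤ r
  · obtain ⟨gs, h, hl⟩ := le_iff_isRuns.1 hsr
    have hne : ∀ g ∈ gs, g ≠ [] := fun g hg => h.ne_nil hg
    have key : (gs.map fun g => ∑ K ∈ splits g, (-1 : ℂ) ^ (K.length - 1) / (K.length : ℂ) *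
        (K.map fun k => 1 / (k.length.factorial : ℂ)).prod).prod = if s = r then 1 else 0 := by
      rw [List.map_congr_left fun g hg => sum_splits (hne g hg)]
      simp only [eq_iff_runs_singleton h hl]
      split_ifs with h1
      · refine List.prod_eq_one fun x hx => ?_
        obtain ⟨g, hg, rfl⟩ := List.mem_map.1 hx
        rw [if_pos (h1 g hg)]
      · push Not at h1
        obtain ⟨g, hg, h1⟩ := h1
        exact List.prod_eq_zero (List.mem_map.2 ⟨g, hg, if_neg h1⟩)
    rw [← key, ← sum_listPi]
    symm
    choose T H hT using fun Ks => exists_between (Ks := Ks) h hl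
    refine Finset.sum_bij T ?_ ?_ ?_ ?_
    · intro Ks hKs
      simp [(hT Ks hKs).1, (hT Ks hKs).2.1]
    · intro Ks hKs Ks' hKs' heq
      obtain ⟨-, -, h1, h2, h3⟩ := hT Ks hKs
      obtain ⟨-, -, h1', h2', h3'⟩ := hT Ks' hKs'
      rw [← heq] at h1' h3'
      rw [h1.unique h1'] at h2
      -- `Ks` is recovered from its flattening, the runs of `t ≤ r`, and from the lengths of its
      -- entries, which are those of the runs of `s ≤ t`.
      refine List.eq_iff_flatten_eq.2 ⟨h3.unique h3', ?_⟩
      rw [← List.map_eq_map_of_forall₂ h2 fun _ _ _ _ h => h,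
        ← List.map_eq_map_of_forall₂ h2' fun _ _ _ _ h => h]
    · intro t ht
      rw [Finset.mem_filter] at ht
      obtain ⟨hs, Ks, h1, h2, h3, h4, h5, h6⟩ := exists_runs_of_chain ht.2.1 ht.2.2
      obtain rfl := h.unique h5
      have hKs : Ks ∈ listPi splits (Ks.map List.flatten) := by
        rw [mem_listPi, List.forall₂_map_left_iff, List.forall₂_same]
        exact fun K hK => mem_splits.2
          ⟨rfl, fun k hk => h3.ne_nil (List.mem_flatten_of_mem hK hk)⟩
      refine ⟨Ks, hKs, ?_⟩
      obtain ⟨-, hle, -, -, h3'⟩ := hT Ks hKs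
      obtain ⟨ks, h7, h8⟩ := le_iff_isRuns.1 hle
      rw [h7.unique h3'] at h8
      exact eq_of_isRuns h3' h8 h3 h4
    · intro Ks hKs
      obtain ⟨-, -, h1, h2, h3⟩ := hT Ks hKs
      rw [LSetComp.relDeg, LSetComp.relDegFactorial, h1.sign_div_relDeg,
        h3.one_div_relDegFactorial, prod_map_flatten, List.prod_map_mul]
      congr 2
      exact (List.map_eq_map_of_forall₂ h2 fun _ _ _ _ h => by rw [h]).symm
  · rw [Finset.filter_false_of_mem, Finset.sum_empty, if_neg]
    · rintro rfl
      exact hsr (le_refl' s)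
    · rintro t - ⟨h1, h2⟩
      exact hsr (le_trans' h1 h2)

/-- Inversion of a triangular system indexed by the refinement order. -/
theorem eq_sum_of_eq_sum [Finite L] {A : Type*} [AddCommGroup A] [Module ℂ A]
    {F K : LSetComp n L → A}
    (h : ∀ s, F s = ∑ t : LSetComp n L with s ≤ t, (1 / (t.relDegFactorial s : ℂ)) • K t)
    (s : LSetComp n L) :
    K s = ∑ t : LSetComp n L with s ≤ t,
      ((-1 : ℂ) ^ (t.length - s.length) / (t.relDeg s : ℂ)) • F t := by
  simp only [h, Finset.smul_sum, smul_smul]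
  rw [Finset.sum_comm' (s' := fun r => Finset.univ.filter fun t => s ≤ t ∧ t ≤ r)
    (t' := Finset.univ)]
  · simp only [← Finset.sum_smul, sum_between]
    simp
  · simp

end LSetComp

/-! ### Multiplication by idempotents -/

/-- The clause on points outside `l` serves the induction: when a head is added, the permutation
found for the tail must fix it. -/
theorem List.Perm.exists_map_eq {A : Type*} {l l' : List A} (h : l.Perm l') (hl : l.Nodup) :
    ∃ σ : Equiv.Perm A, l.map σ = l' ∧ ∀ x, x ∉ l → σ x = x := by
  induction h with
  | nil => exact ⟨1, by simp⟩
  | @cons a l l' _ ih =>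
    obtain ⟨σ, h1, h2⟩ := ih (List.nodup_cons.1 hl).2
    refine ⟨σ, by rw [List.map_cons, h1, h2 _ (List.nodup_cons.1 hl).1], fun x hx => h2 x ?_⟩
    exact fun h => hx (List.mem_cons_of_mem _ h)
  | swap a b l =>
    simp only [List.nodup_cons, List.mem_cons, not_or] at hl
    refine ⟨Equiv.swap a b, ?_, ?_⟩
    · simp only [List.map_cons, Equiv.swap_apply_left, Equiv.swap_apply_right, List.cons.injEq,
        true_and]
      refine (List.map_congr_left fun x hx => Equiv.swap_apply_of_ne_of_ne ?_ ?_).trans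
        (List.map_id l)
      · rintro rfl
        exact hl.2.1 hx
      · rintro rfl
        exact hl.1.2 hx
    · intro x hx
      simp only [List.mem_cons, not_or] at hx
      exact Equiv.swap_apply_of_ne_of_ne hx.2.1 hx.1
  | trans h1 _ ih1 ih2 =>
    obtain ⟨σ, h3, h4⟩ := ih1 hl
    obtain ⟨τ, h5, h6⟩ := ih2 (h1.nodup_iff.1 hl)
    refine ⟨τ * σ, ?_, fun x hx => ?_⟩
    · rw [← h5, ← h3, List.map_map]
      rfl
    · rw [Equiv.Perm.mul_apply, h4 x hx, h6 x fun h => hx (h1.mem_iff.2 h)]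

namespace LSetComp

variable {n : ℕ} {L M : Type*}

theorem mem_supp {s : LSetComp n L} {A : Finset (Fin n)} :
    A ∈ s.supp.parts ↔ ∃ b ∈ s.blocks, b.1 = A := by
  simp [supp]

theorem nodup_map_fst (s : LSetComp n L) : (s.blocks.map Prod.fst).Nodup := by
  rw [List.Nodup, List.pairwise_map]
  refine s.disjoint.imp_of_mem ?_
  intro a b ha _ hab h
  rw [h] at hab
  exact (s.nonempty a ha).ne_empty (h ▸ disjoint_self.1 hab)

theorem card_supp (s : LSetComp n L) : s.supp.parts.card = s.blocks.length := by
  have : s.supp.parts = (s.blocks.map Prod.fst).toFinset := by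
    ext A
    simp [mem_supp]
  rw [this, List.toFinset_card_of_nodup s.nodup_map_fst, List.length_map]

theorem perm_map_fst_of_supp_eq {s : LSetComp n L} {t : LSetComp n M} (h : s.supp = t.supp) :
    (s.blocks.map Prod.fst).Perm (t.blocks.map Prod.fst) := by
  rw [List.perm_ext_iff_of_nodup s.nodup_map_fst t.nodup_map_fst]
  intro A
  have := congrArg (fun X => A ∈ Finpartition.parts X) h
  simpa only [mem_supp, eq_iff_iff, ← List.mem_map] using this

@[simp]
theorem supp_abs (s : LSetComp n L) : s.abs.supp = s.supp := by
  ext A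
  simp [mem_supp, abs, relabel]

theorem block_eq_of_inter_nonempty (s : LSetComp n L) {a b : Finset (Fin n) × L}
    (ha : a ∈ s.blocks) (hb : b ∈ s.blocks) (h : (a.1 ∩ b.1).Nonempty) : a = b := by
  obtain ⟨i, hi⟩ := h
  rw [Finset.mem_inter] at hi
  obtain ⟨j, hj, rfl⟩ := List.getElem_of_mem ha
  obtain ⟨k, hk, rfl⟩ := List.getElem_of_mem hb
  simp only [s.mem_block_unique hj hk hi.1 hi.2]

/-- The `L`-composition with a rearranged list of blocks. -/
def ofPerm (t : LSetComp n L) (l : List (Finset (Fin n) × L)) (h : l.Perm t.blocks) :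
    LSetComp n L where
  blocks := l
  nonempty b hb := t.nonempty b (h.mem_iff.1 hb)
  disjoint := (h.pairwise_iff fun h => h.symm).2 t.disjoint
  cover i := by
    obtain ⟨b, hb, hi⟩ := t.cover i
    exact ⟨b, h.mem_iff.2 hb, hi⟩

theorem supp_ofPerm (t : LSetComp n L) (l : List (Finset (Fin n) × L)) (h : l.Perm t.blocks) :
    (t.ofPerm l h).supp = t.supp := by
  ext A
  simp only [mem_supp, ofPerm, h.mem_iff]

theorem supp_le_of_le {s t : LSetComp n L} (h : s ≤ t) : t.supp ≤ s.supp := by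
  obtain ⟨gs, h1, -⟩ := le_iff_isRuns.1 h
  intro B hB
  obtain ⟨b, hb, rfl⟩ := mem_supp.1 hB
  rw [← h1.1] at hb
  obtain ⟨g, hg, hb⟩ := List.mem_flatten.1 hb
  obtain ⟨j, hj, rfl⟩ := List.getElem_of_mem hg
  have hj' : j < s.blocks.length := h1.length_eq ▸ hj
  exact ⟨_, mem_supp.2 ⟨_, List.get_mem _ ⟨j, hj'⟩, rfl⟩, fun i hi =>
    ((List.forall₂_iff_get.1 h1.2).2 j hj' hj i).2 ⟨b, hb, hi⟩⟩

/-- Equal supports give equally many blocks, and nonempty runs whose number equals their total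
length are singletons. -/
theorem eq_of_le_of_supp_eq {s t : LSetComp n L} (h : s ≤ t) (hst : t.supp = s.supp) : s = t := by
  obtain ⟨gs, h1, h2⟩ := le_iff_isRuns.1 h
  rw [eq_iff_runs_singleton h1 h2]
  have hlen : gs.flatten.length = gs.length := by
    rw [h1.1, ← h1.length_eq, ← card_supp, ← card_supp, hst]
  have hne : ∀ g ∈ gs, g ≠ [] := fun g hg => h1.ne_nil hg
  clear h1 h2
  induction gs with
  | nil => simp
  | cons g gs ih =>
    have hne' : ∀ g ∈ gs, g ≠ [] := fun g hg => hne g (List.mem_cons_of_mem _ hg)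
    have h1 := length_le_length_flatten hne'
    have h2 : 0 < g.length := List.length_pos_iff.2 (hne g List.mem_cons_self)
    simp only [List.flatten_cons, List.length_append, List.length_cons] at hlen
    rw [List.forall_mem_cons]
    exact ⟨by omega, ih (by omega) hne'⟩

/-- Every block of `y` lies in a single block of `s`, so an intersection is either empty or a whole
block of `y`; multiplying by `1` keeps the label of `s`. -/
theorem mul_ofSetComp_blocks {G : Type*} [Group G] {s : LSetComp n G} {y : SetComp n}
    (h : y.supp ≤ s.supp) : (s * ofSetComp G y).blocks = (s.blocks.map fun a =>
      (y.blocks.filter fun b => b.1 ⊆ a.1).map fun b => (b.1, a.2)).flatten := by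
  change dropEmpty (rawMul s.blocks (y.blocks.map fun b => (b.1, (1 : G)))) = _
  rw [dropEmpty, rawMul, List.filter_flatMap, List.flatMap_def]
  congr 1
  refine List.map_congr_left fun a ha => ?_
  rw [List.map_map, List.filter_map]
  have key : ∀ b ∈ y.blocks, (a.1 ∩ b.1).Nonempty ↔ b.1 ⊆ a.1 := by
    intro b hb
    constructor
    · intro hab
      obtain ⟨c, hc, hbc⟩ := h (mem_supp.2 ⟨b, hb, rfl⟩)
      obtain ⟨d, hd, rfl⟩ := mem_supp.1 hc
      rw [s.block_eq_of_inter_nonempty ha hd (hab.mono (Finset.inter_subset_inter_left hbc))]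
      exact hbc
    · intro hba
      rw [Finset.inter_eq_right.2 hba]
      exact y.nonempty b hb
  rw [List.filter_congr (q := fun b => decide (b.1 ⊆ a.1))]
  · refine List.map_congr_left fun b hb => ?_
    have hba : b.1 ⊆ a.1 := by simpa using (List.mem_filter.1 hb).2
    simp [Finset.inter_eq_right.2 hba]
  · intro b hb
    simp [key b hb]

theorem le_mul_ofSetComp {G : Type*} [Group G] {s : LSetComp n G} {y : SetComp n}
    (h : y.supp ≤ s.supp) : s ≤ s * ofSetComp G y := by
  refine ⟨_, (mul_ofSetComp_blocks h).symm, ?_⟩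
  rw [List.forall₂_map_right_iff, List.forall₂_same]
  refine fun a ha => ⟨fun i => ?_, fun b hb => ?_⟩
  · constructor
    · intro hi
      obtain ⟨b, hb, hib⟩ := y.cover i
      obtain ⟨c, hc, hbc⟩ := h (mem_supp.2 ⟨b, hb, rfl⟩)
      obtain ⟨d, hd, rfl⟩ := mem_supp.1 hc
      obtain rfl := s.block_eq_of_inter_nonempty ha hd ⟨i, Finset.mem_inter.2 ⟨hi, hbc hib⟩⟩
      exact ⟨_, List.mem_map.2 ⟨b, List.mem_filter.2 ⟨hb, decide_eq_true hbc⟩, rfl⟩, hib⟩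
    · rintro ⟨b, hb, hi⟩
      obtain ⟨c, hc, rfl⟩ := List.mem_map.1 hb
      have hca : c.1 ⊆ a.1 := by simpa using (List.mem_filter.1 hc).2
      exact hca hi
  · obtain ⟨b, hb, rfl⟩ := List.mem_map.1 hb
    rfl

theorem supp_mul_ofSetComp {G : Type*} [Group G] {s : LSetComp n G} {y : SetComp n}
    (h : y.supp ≤ s.supp) : (s * ofSetComp G y).supp = y.supp := by
  ext A
  rw [mem_supp, mem_supp, mul_ofSetComp_blocks h]
  constructor
  · rintro ⟨b, hb, rfl⟩
    obtain ⟨l, hl, hb⟩ := List.mem_flatten.1 hb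
    obtain ⟨a, ha, rfl⟩ := List.mem_map.1 hl
    obtain ⟨c, hc, rfl⟩ := List.mem_map.1 hb
    exact ⟨c, List.mem_of_mem_filter hc, rfl⟩
  · rintro ⟨b, hb, rfl⟩
    obtain ⟨c, hc, hbc⟩ := h (mem_supp.2 ⟨b, hb, rfl⟩)
    obtain ⟨d, hd, rfl⟩ := mem_supp.1 hc
    exact ⟨_, List.mem_flatten_of_mem (List.mem_map.2 ⟨d, hd, rfl⟩)
      (List.mem_map.2 ⟨b, List.mem_filter.2 ⟨hb, decide_eq_true hbc⟩, rfl⟩), rfl⟩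

theorem mul_ofSetComp_of_supp_eq {G : Type*} [Group G] {s : LSetComp n G} {y : SetComp n}
    (h : y.supp = s.supp) : s * ofSetComp G y = s :=
  (eq_of_le_of_supp_eq (le_mul_ofSetComp h.le) ((supp_mul_ofSetComp h.le).trans h)).symm

/-! ### Counting refinements of given support -/

/-- Since the blocks of `s` are disjoint, a block of `t` contained in one of them must come from its
run. Only the order inside a run is left free. -/
theorem IsRuns.mem_iff {s : LSetComp n L} {t : LSetComp n M}
    {gs : List (List (Finset (Fin n) × M))} (h : IsRuns s t gs) :
    List.Forall₂ (fun a g => ∀ b, b ∈ g ↔ b ∈ t.blocks ∧ b.1 ⊆ a.1) s.blocks gs := by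
  refine List.forall₂_iff_get.2 ⟨h.length_eq, fun j hj hj' b => ?_⟩
  have hu : ∀ k (hk : k < s.blocks.length) (hk' : k < gs.length), ∀ c ∈ gs[k],
      c.1 ⊆ s.blocks[k].1 := fun k hk hk' c hc i hi =>
    ((List.forall₂_iff_get.1 h.2).2 k hk hk' i).2 ⟨c, hc, hi⟩
  simp only [List.get_eq_getElem] at *
  constructor
  · exact fun hb => ⟨h.mem_blocks (List.getElem_mem _) hb, hu j hj hj' b hb⟩
  · rintro ⟨hb, h2⟩
    obtain ⟨i, hi⟩ := t.nonempty b hb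
    rw [← h.1] at hb
    obtain ⟨g, hg, hbg⟩ := List.mem_flatten.1 hb
    obtain ⟨k, hk, rfl⟩ := List.getElem_of_mem hg
    have hk' : k < s.blocks.length := h.length_eq ▸ hk
    obtain rfl := s.mem_block_unique hk' hj (hu k hk' hk b hbg hi) (h2 hi)
    exact hbg

/-- The criterion sees `t` only through its support, so refinements of `s` with equal support have
runs with the same members. -/
theorem mem_run_iff {s t : LSetComp n L} {gs : List (List (Finset (Fin n) × L))}
    (h : IsRuns s t gs) (hl : List.Forall₂ (fun a g => ∀ b ∈ g, b.2 = a.2) s.blocks gs) :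
    List.Forall₂ (fun a g => ∀ b, b ∈ g ↔ b.1 ∈ t.supp.parts ∧ b.1 ⊆ a.1 ∧ b.2 = a.2)
      s.blocks gs := by
  refine h.mem_iff.mp (fun a g h1 h2 b => ?_) hl
  constructor
  · exact fun hb => ⟨mem_supp.2 ⟨b, ((h1 b).1 hb).1, rfl⟩, ((h1 b).1 hb).2, h2 b hb⟩
  · rintro ⟨hb, hba, hb2⟩
    obtain ⟨c, hc, hcb⟩ := mem_supp.1 hb
    have hcg := (h1 c).2 ⟨hc, hcb ▸ hba⟩
    obtain rfl : c = b := Prod.ext hcb ((h2 c hcg).trans hb2.symm)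
    exact hcg

theorem perm_runs {s t t' : LSetComp n L} {gs hs : List (List (Finset (Fin n) × L))}
    (h : IsRuns s t gs) (hl : List.Forall₂ (fun a g => ∀ b ∈ g, b.2 = a.2) s.blocks gs)
    (h' : IsRuns s t' hs) (hl' : List.Forall₂ (fun a g => ∀ b ∈ g, b.2 = a.2) s.blocks hs)
    (hsupp : t.supp = t'.supp) : List.Forall₂ List.Perm gs hs := by
  have h1 := mem_run_iff h hl
  have h2 := mem_run_iff h' hl'
  rw [← hsupp] at h2
  have hn : (gs.flatten).Nodup := h.1 ▸ t.nodup_blocks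
  have hn' : (hs.flatten).Nodup := h'.1 ▸ t'.nodup_blocks
  rw [List.nodup_flatten] at hn hn'
  refine List.forall₂_iff_get.2 ⟨h.length_eq.symm.trans h'.length_eq, fun j hj hj' => ?_⟩
  have hj0 : j < s.blocks.length := h.length_eq ▸ hj
  rw [List.perm_ext_iff_of_nodup (hn.1 _ (List.get_mem _ _)) (hn'.1 _ (List.get_mem _ _))]
  exact fun b => ((List.forall₂_iff_get.1 h1).2 j hj0 hj b).trans
    ((List.forall₂_iff_get.1 h2).2 j hj0 hj' b).symm

/-- The refinements of `s` with the support of `t` arise by permuting each run independently, and a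
run of `m` distinct blocks has `m!` orderings. -/
theorem card_refinements_of_supp [Finite L] {s t : LSetComp n L} (hst : s ≤ t) :
    (Finset.univ.filter fun t' : LSetComp n L => s ≤ t' ∧ t'.supp = t.supp).card =
      t.relDegFactorial s := by
  obtain ⟨gs, h, hl⟩ := le_iff_isRuns.1 hst
  have hn : (gs.flatten).Nodup := h.1 ▸ t.nodup_blocks
  rw [List.nodup_flatten] at hn
  have hcard : (listPi (fun g : List (Finset (Fin n) × L) => g.permutations.toFinset) gs).card =
      t.relDegFactorial s := by
    have := sum_listPi (fun g : List (Finset (Fin n) × L) => g.permutations.toFinset)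
      (fun _ => (1 : ℕ)) gs
    simp only [List.map_const', List.prod_replicate, one_pow, Finset.sum_const, smul_eq_mul,
      mul_one] at this
    rw [this, relDegFactorial, h.relDegFactorial_eq]
    congr 1
    refine List.map_congr_left fun g hg => ?_
    rw [List.toFinset_card_of_nodup (List.nodup_permutations g (hn.1 g hg)),
      List.length_permutations]
  rw [← hcard]
  symm
  have hperm : ∀ Ks, Ks ∈ listPi (fun g : List (Finset (Fin n) × L) => g.permutations.toFinset) gs →
      List.Forall₂ List.Perm gs Ks := fun Ks hKs => (mem_listPi.1 hKs).imp fun g K hK =>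
    (List.mem_permutations.1 (List.mem_toFinset.1 hK)).symm
  have hflat : ∀ {Ks}, List.Forall₂ List.Perm gs Ks → Ks.flatten.Perm t.blocks := by
    intro Ks hKs
    rw [← h.1]
    clear * - hKs
    induction hKs with
    | nil => exact .nil
    | cons h _ ih => exact h.symm.append ih
  have hruns : ∀ {Ks} (hKs : List.Forall₂ List.Perm gs Ks),
      IsRuns s (t.ofPerm Ks.flatten (hflat hKs)) Ks ∧
        List.Forall₂ (fun a g => ∀ b ∈ g, b.2 = a.2) s.blocks Ks := by
    intro Ks hKs
    have h1 := (List.forall₂_iff_get.1 hKs)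
    refine ⟨⟨rfl, List.forall₂_iff_get.2 ⟨h.length_eq.trans h1.1, fun j hj hj' i => ?_⟩⟩,
      List.forall₂_iff_get.2 ⟨h.length_eq.trans h1.1, fun j hj hj' b hb => ?_⟩⟩
    · refine ((List.forall₂_iff_get.1 h.2).2 j hj (h1.1 ▸ hj') i).trans ?_
      simp only [(h1.2 j (h1.1 ▸ hj') hj').mem_iff]
    · exact (List.forall₂_iff_get.1 hl).2 j hj (h1.1 ▸ hj') b
        ((h1.2 j (h1.1 ▸ hj') hj').mem_iff.2 hb)
  refine Finset.card_bij (fun Ks hKs => t.ofPerm Ks.flatten (hflat (hperm Ks hKs))) ?_ ?_ ?_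
  · intro Ks hKs
    obtain ⟨h1, h2⟩ := hruns (hperm Ks hKs)
    rw [Finset.mem_filter]
    exact ⟨Finset.mem_univ _, le_iff_isRuns.2 ⟨_, h1, h2⟩, supp_ofPerm _ _ _⟩
  · intro Ks hKs Ks' hKs' heq
    have h1 := (hruns (hperm Ks hKs)).1
    rw [heq] at h1
    exact h1.unique (hruns (hperm Ks' hKs')).1
  · intro t' ht'
    rw [Finset.mem_filter] at ht'
    obtain ⟨hs, h1, h2⟩ := le_iff_isRuns.1 ht'.2.1
    refine ⟨hs, ?_, ?_⟩
    · refine mem_listPi.2 ((perm_runs h hl h1 h2 ht'.2.2.symm).imp fun g K hK => ?_)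
      exact List.mem_toFinset.2 (List.mem_permutations.2 hK.symm)
    · exact LSetComp.ext h1.1

/-- Matching the blocks of `t` and `t'` by position gives a permutation `σ` of sets that respects
containment in the blocks of `s`. Applying `σ` to the blocks of `y` is injective and carries
solutions of `s y = t` to solutions of `s y = t'`. Exchanging `t` and `t'` will give equality. -/
theorem card_mul_eq_le {G : Type*} [Group G] {s t t' : LSetComp n G} (hst : s ≤ t)
    (hst' : s ≤ t') (hsupp : t.supp = t'.supp) :
    (Finset.univ.filter fun y : SetComp n => y.supp = t.supp ∧ s * ofSetComp G y = t).card ≤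
      (Finset.univ.filter fun y : SetComp n => y.supp = t.supp ∧ s * ofSetComp G y = t').card := by
  obtain ⟨gs, h, hl⟩ := le_iff_isRuns.1 hst
  obtain ⟨hs, h', hl'⟩ := le_iff_isRuns.1 hst'
  have hp := perm_runs h hl h' hl' hsupp
  obtain ⟨σ, hσ, -⟩ := (perm_map_fst_of_supp_eq hsupp).exists_map_eq t.nodup_map_fst
  -- Corresponding runs have equal lengths, so the equality of the concatenated lists holds run by
  -- run.
  have hσr : gs.map (List.map fun b => σ b.1) = hs.map (List.map Prod.fst) := by
    rw [List.eq_iff_flatten_eq]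
    constructor
    · rw [← List.map_flatten, ← List.map_flatten, h.1, h'.1, ← hσ, List.map_map]
      rfl
    · rw [List.map_map, List.map_map]
      exact List.map_eq_map_of_forall₂ hp fun g K _ _ hgK => by simpa using hgK.length_eq
  have hσb : gs.map (List.map (Prod.map σ id)) = hs := by
    rw [← List.forall₂_eq_eq_eq, List.forall₂_map_left_iff] at hσr ⊢
    rw [List.forall₂_map_right_iff] at hσr
    refine List.forall₂_iff_get.2 ⟨hσr.length_eq, fun j hj hj' => ?_⟩
    have e := (List.forall₂_iff_get.1 hσr).2 j hj hj'
    have hj0 : j < s.blocks.length := h.length_eq ▸ hj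
    have l1 := (List.forall₂_iff_get.1 hl).2 j hj0 hj
    have l2 := (List.forall₂_iff_get.1 hl').2 j hj0 hj'
    rw [← List.forall₂_eq_eq_eq, List.forall₂_map_left_iff, List.forall₂_map_right_iff] at e
    rw [← List.forall₂_eq_eq_eq, List.forall₂_map_left_iff]
    refine List.forall₂_iff_get.2 ⟨e.length_eq, fun k hk hk' => Prod.ext ?_ ?_⟩
    · exact (List.forall₂_iff_get.1 e).2 k hk hk'
    · exact (l1 _ (List.get_mem _ _)).trans (l2 _ (List.get_mem _ _)).symm
  have hblocks : t.blocks.map (Prod.map σ id) = t'.blocks := by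
    rw [← h.1, ← h'.1, ← hσb, List.map_flatten]
  have hsub : ∀ a ∈ s.blocks, ∀ B ∈ t.supp.parts, σ B ⊆ a.1 ↔ B ⊆ a.1 := by
    intro a ha B hB
    obtain ⟨b, hb, rfl⟩ := mem_supp.1 hB
    have hne := t.nonempty b hb
    rw [← h.1] at hb
    obtain ⟨g, hg, hbg⟩ := List.mem_flatten.1 hb
    obtain ⟨j, hj, rfl⟩ := List.getElem_of_mem hg
    have hj0 : j < s.blocks.length := h.length_eq ▸ hj
    have hj' : j < hs.length := h'.length_eq ▸ hj0
    have m1 := ((List.forall₂_iff_get.1 (mem_run_iff h hl)).2 j hj0 hj b).1 hbg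
    have hb' : Prod.map σ id b ∈ hs[j] := by
      simp only [← hσb, List.getElem_map]
      exact List.mem_map_of_mem hbg
    have m2 := ((List.forall₂_iff_get.1 (mem_run_iff h' hl')).2 j hj0 hj' _).1 hb'
    have hne2 := t'.nonempty _ (h'.mem_blocks (List.getElem_mem hj') hb')
    constructor
    · intro hs
      rw [s.block_eq_of_inter_nonempty ha (List.getElem_mem hj0)
        (hne2.mono (Finset.subset_inter hs m2.2.1))]
      exact m1.2.1
    · intro hs
      rw [s.block_eq_of_inter_nonempty ha (List.getElem_mem hj0)
        (hne.mono (Finset.subset_inter hs m1.2.1))]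
      exact m2.2.1
  -- `σ` permutes the common support of `t` and `t'`, so it merely rearranges the blocks of `y`.
  have hyp : ∀ y : SetComp n, y.supp = t.supp → (y.blocks.map (Prod.map σ id)).Perm y.blocks := by
    intro y hy
    have p1 := perm_map_fst_of_supp_eq hy
    have p2 := perm_map_fst_of_supp_eq (hy.trans hsupp)
    have p3 := p1.map σ
    rw [hσ] at p3
    have p4 := (p3.trans p2.symm).map fun B => (B, ())
    rw [List.map_map, List.map_map, List.map_map] at p4
    exact p4.trans (.of_eq (List.map_id _))
  refine Finset.card_le_card_of_injOn
    (fun y => if hy : y.supp = t.supp then y.ofPerm _ (hyp y hy) else y) ?_ ?_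
  · intro y hy
    have hy := (Finset.mem_filter.1 hy).2
    simp only [dif_pos hy.1]
    rw [Finset.mem_coe, Finset.mem_filter, supp_ofPerm]
    refine ⟨Finset.mem_univ _, hy.1, LSetComp.ext ?_⟩
    have hle : y.supp ≤ s.supp := hy.1 ▸ supp_le_of_le hst
    rw [mul_ofSetComp_blocks (by rwa [supp_ofPerm]), ← hblocks, ← congrArg LSetComp.blocks hy.2,
      mul_ofSetComp_blocks hle, List.map_flatten, List.map_map]
    congr 1
    refine List.map_congr_left fun a ha => ?_
    simp only [ofPerm, Function.comp_apply, List.filter_map, List.map_map]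
    rw [List.filter_congr (q := fun b => decide (b.1 ⊆ a.1))]
    · rfl
    · intro b hb
      simpa using hsub a ha b.1 (hy.1 ▸ mem_supp.2 ⟨b, hb, rfl⟩)
  · intro y hy y' hy' heq
    have hy := (Finset.mem_filter.1 hy).2
    have hy' := (Finset.mem_filter.1 hy').2
    simp only [dif_pos hy.1, dif_pos hy'.1] at heq
    exact LSetComp.ext (List.map_injective_iff.2 (σ.injective.prodMap Function.injective_id)
      (congrArg LSetComp.blocks heq))

/-- The proportion of the orderings of `supp t` that multiply `s` to `t`. -/
theorem card_mul_eq_div {G : Type*} [Group G] [Finite G] {s t : LSetComp n G} (hst : s ≤ t) :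
    ((Finset.univ.filter fun y : SetComp n => y.supp = t.supp ∧ s * ofSetComp G y = t).card : ℂ) /
      ((Finset.univ.filter fun y : SetComp n => y.supp = t.supp).card : ℂ) =
      1 / (t.relDegFactorial s : ℂ) := by
  have hle : t.supp ≤ s.supp := supp_le_of_le hst
  -- The map `y ↦ s y` sends the orderings of `supp t` to the `deg!(t/s)` refinements of `s` with
  -- this support, and all its fibres have the same size.
  have hsum := Finset.card_eq_sum_card_fiberwise
    (s := Finset.univ.filter fun y : SetComp n => y.supp = t.supp)
    (t := Finset.univ.filter fun t' : LSetComp n G => s ≤ t' ∧ t'.supp = t.supp)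
    (f := fun y => s * ofSetComp G y) (by
      intro y hy
      have hy := (Finset.mem_filter.1 hy).2
      simp only [Finset.coe_filter, Finset.mem_univ, true_and, Set.mem_ofPred_eq]
      exact ⟨le_mul_ofSetComp (hy.le.trans hle), (supp_mul_ofSetComp (hy.le.trans hle)).trans hy⟩)
  have hconst : ∀ t' ∈ Finset.univ.filter fun t' : LSetComp n G => s ≤ t' ∧ t'.supp = t.supp,
      ((Finset.univ.filter fun y : SetComp n => y.supp = t.supp).filter
        fun y => s * ofSetComp G y = t').card =
      (Finset.univ.filter fun y : SetComp n => y.supp = t.supp ∧ s * ofSetComp G y = t).card := by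
    intro t' ht'
    rw [Finset.mem_filter] at ht'
    rw [Finset.filter_filter]
    refine le_antisymm ?_ (card_mul_eq_le hst ht'.2.1 ht'.2.2.symm)
    have := card_mul_eq_le ht'.2.1 hst ht'.2.2
    rwa [ht'.2.2] at this
  rw [Finset.sum_congr rfl hconst, Finset.sum_const, smul_eq_mul, card_refinements_of_supp hst]
    at hsum
  have hpos : 0 < (Finset.univ.filter fun y : SetComp n => y.supp = t.supp).card :=
    Finset.card_pos.2 ⟨t.abs, by simp⟩
  rw [hsum] at hpos ⊢
  have h1 : (t.relDegFactorial s : ℂ) ≠ 0 :=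
    Nat.cast_ne_zero.2 (Nat.pos_of_mul_pos_right hpos).ne'
  have h2 := Nat.cast_ne_zero (R := ℂ).2 (Nat.pos_of_mul_pos_left hpos).ne'
  push_cast
  field_simp

end LSetComp

namespace Hsiao

/-! ### The bases `H` and `R` -/

section Group

variable {n : ℕ} {G : Type*}

theorem card_supp_eq_ne_zero (s : LSetComp n G) :
    ((Finset.univ.filter fun x : SetComp n => x.supp = s.supp).card : ℂ) ≠ 0 :=
  Nat.cast_ne_zero.2 (Finset.card_pos.2 ⟨s.abs, by simp⟩).ne'

variable [Group G]

theorem H_mul_H_ofSetComp (s : LSetComp n G) (x : SetComp n) :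
    H s * H (LSetComp.ofSetComp G x) = H (s * LSetComp.ofSetComp G x) := by
  rw [H, H, H, MonoidAlgebra.single_mul_single, one_mul]

theorem supp_ofSetComp (x : SetComp n) : (LSetComp.ofSetComp G x).supp = x.supp := by
  ext A
  simp [LSetComp.mem_supp, LSetComp.ofSetComp, LSetComp.relabel]

theorem u_eq (X : Finpartition (Finset.univ : Finset (Fin n))) :
    u G X = e G X + ∑ Y : {Y : Finpartition (Finset.univ : Finset (Fin n)) // Y < X},
      u G X * e G Y.1 := by
  rw [e]
  abel

theorem H_mul_u_supp (s : LSetComp n G) : H s * u G s.supp = H s := by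
  rw [u, mul_smul_comm, Finset.mul_sum]
  have : ∀ y ∈ Finset.univ.filter (fun y : SetComp n => y.supp = s.supp),
      H s * H (LSetComp.ofSetComp G y) = H s := by
    intro y hy
    rw [H_mul_H_ofSetComp, LSetComp.mul_ofSetComp_of_supp_eq (Finset.mem_filter.1 hy).2]
  rw [Finset.sum_congr rfl this, Finset.sum_const, ← Nat.cast_smul_eq_nsmul ℂ, smul_smul,
    one_div_mul_cancel (card_supp_eq_ne_zero s), one_smul]

theorem u_mul_u (X : Finpartition (Finset.univ : Finset (Fin n))) : u G X * u G X = u G X := by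
  conv_lhs => enter [1]; rw [u]
  rw [smul_mul_assoc, Finset.sum_mul]
  conv_rhs => rw [u]
  congr 1
  refine Finset.sum_congr rfl fun x hx => ?_
  have h := H_mul_u_supp (LSetComp.ofSetComp G x)
  rwa [supp_ofSetComp, (Finset.mem_filter.1 hx).2] at h

/-- Every term of the recursion for `e` starts with the idempotent `u`. -/
theorem u_mul_e (X : Finpartition (Finset.univ : Finset (Fin n))) : u G X * e G X = e G X := by
  conv_lhs => rw [e]
  conv_rhs => rw [e]
  simp only [mul_sub, Finset.mul_sum, ← mul_assoc, u_mul_u]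

/-- Write `H_s = H_s u_{supp s}` and expand `u`; the factor `u` in front of each remaining `e°_Y` is
absorbed by `H_s`. -/
theorem H_eq_sum_e (s : LSetComp n G) : H s =
    ∑ Y : Finpartition (Finset.univ : Finset (Fin n)) with Y ≤ s.supp, H s * e G Y := by
  conv_lhs => rw [← H_mul_u_supp s, u_eq, mul_add, Finset.mul_sum]
  simp only [← mul_assoc, H_mul_u_supp]
  rw [← Finset.add_sum_erase (Finset.univ.filter fun Y => Y ≤ s.supp) _
    (Finset.mem_filter.2 ⟨Finset.mem_univ _, le_refl s.supp⟩)]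
  congr 1
  rw [← Finset.sum_subtype _ (p := fun Y => Y < s.supp) (f := fun Y => H s * e G Y)]
  intro Y
  simp [lt_iff_le_and_ne, and_comm]

variable [Finite G]

/-- The average defining `u_Y` is sorted by the value of `s y`; the proportion of each value is
`card_mul_eq_div`. -/
theorem H_mul_u {s : LSetComp n G} {Y : Finpartition (Finset.univ : Finset (Fin n))}
    (hY : Y ≤ s.supp) : H s * u G Y =
      ∑ t : LSetComp n G with s ≤ t ∧ t.supp = Y, (1 / (t.relDegFactorial s : ℂ)) • H t := by
  rw [u, mul_smul_comm, Finset.mul_sum, ← Finset.sum_fiberwise_of_maps_to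
    (t := Finset.univ.filter fun t : LSetComp n G => s ≤ t ∧ t.supp = Y)
    (g := fun y => s * LSetComp.ofSetComp G y), Finset.smul_sum]
  · refine Finset.sum_congr rfl fun t ht => ?_
    obtain ⟨hst, rfl⟩ := (Finset.mem_filter.1 ht).2
    rw [← LSetComp.card_mul_eq_div hst, Finset.filter_filter]
    have : ∀ y ∈ Finset.univ.filter
        (fun y : SetComp n => y.supp = t.supp ∧ s * LSetComp.ofSetComp G y = t),
        H s * H (LSetComp.ofSetComp G y) = H t := by
      intro y hy
      rw [H_mul_H_ofSetComp, (Finset.mem_filter.1 hy).2.2]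
    rw [Finset.sum_congr rfl this, Finset.sum_const, ← Nat.cast_smul_eq_nsmul ℂ, smul_smul,
      div_mul_eq_mul_div, one_mul]
  · intro y hy
    obtain rfl := (Finset.mem_filter.1 hy).2
    rw [Finset.mem_filter]
    exact ⟨Finset.mem_univ _, LSetComp.le_mul_ofSetComp hY, LSetComp.supp_mul_ofSetComp hY⟩

theorem H_mul_e_eq (s : LSetComp n G) {Y : Finpartition (Finset.univ : Finset (Fin n))}
    (hY : Y ≤ s.supp) : H s * e G Y =
      ∑ t : LSetComp n G with s ≤ t ∧ t.supp = Y, (1 / (t.relDegFactorial s : ℂ)) • R t := by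
  rw [← u_mul_e, ← mul_assoc, H_mul_u hY, Finset.sum_mul]
  refine Finset.sum_congr rfl fun t ht => ?_
  obtain ⟨-, rfl⟩ := (Finset.mem_filter.1 ht).2
  rw [smul_mul_assoc, R, LSetComp.supp_abs]

theorem H_eq_sum_R (s : LSetComp n G) :
    H s = ∑ t : LSetComp n G with s ≤ t, (1 / (t.relDegFactorial s : ℂ)) • R t := by
  rw [H_eq_sum_e, ← Finset.sum_fiberwise_of_maps_to
    (t := Finset.univ.filter fun Y => Y ≤ s.supp) (g := fun t : LSetComp n G => t.supp)]
  · refine Finset.sum_congr rfl fun Y hY => ?_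
    rw [H_mul_e_eq s (Finset.mem_filter.1 hY).2, Finset.filter_filter]
  · intro t ht
    simpa using LSetComp.supp_le_of_le (Finset.mem_filter.1 ht).2

theorem R_eq_sum_H (s : LSetComp n G) :
    R s = ∑ t : LSetComp n G with s ≤ t,
      ((-1 : ℂ) ^ (t.length - s.length) / (t.relDeg s : ℂ)) • H t :=
  LSetComp.eq_sum_of_eq_sum H_eq_sum_R s

theorem length_type {L : Type*} (s : LSetComp n L) : s.type.length = s.length :=
  List.length_map _

theorem SR_eq_sum_SH (p : LIntComp n G) :
    SR p = ∑ q : LIntComp n G with p ≤ q,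
      ((-1 : ℂ) ^ (q.length - p.length) / (q.abs.relDeg p.abs : ℂ)) • SH q := by
  have h := LSetComp.sum_type_sum_refines (C := fun a l => ∀ b ∈ l, b = a)
    (fun p q : LIntComp n G => (-1 : ℂ) ^ (q.length - p.length) / (q.abs.relDeg p.abs : ℂ)) H p
  simp only [← LSetComp.le_iff_refines, ← LIntComp.le_iff_refines, length_type] at h
  simp only [SR, SH, ← h, R_eq_sum_H, LSetComp.relDeg]

end Group

end Hsiao

/-! ### Labels as functions on blocks -/

namespace LSetComp

variable {n : ℕ} {L M : Type*}

theorem abs_eq_abs_iff {s : LSetComp n L} {t : LSetComp n M} :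
    s.abs = t.abs ↔ s.blocks.map Prod.fst = t.blocks.map Prod.fst := by
  rw [LSetComp.ext_iff]
  change s.blocks.map (fun b => (b.1, ())) = t.blocks.map (fun b => (b.1, ())) ↔ _
  constructor
  · intro h
    simpa [Function.comp_def] using congrArg (List.map Prod.fst) h
  · intro h
    simpa [Function.comp_def] using congrArg (List.map fun B => (B, ())) h

/-- Replace the labels of the blocks. -/
def ofMapFst (s : LSetComp n M) (l : List (Finset (Fin n) × L))
    (h : l.map Prod.fst = s.blocks.map Prod.fst) : LSetComp n L where
  blocks := l
  nonempty := by
    intro b hb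
    have : b.1 ∈ s.blocks.map Prod.fst := h ▸ List.mem_map_of_mem hb
    obtain ⟨c, hc, hcb⟩ := List.mem_map.1 this
    exact hcb ▸ s.nonempty c hc
  disjoint := by
    have : (s.blocks.map Prod.fst).Pairwise Disjoint := List.pairwise_map.2 s.disjoint
    rw [← h] at this
    exact List.pairwise_map.1 this
  cover := by
    intro i
    obtain ⟨b, hb, hi⟩ := s.cover i
    have : b.1 ∈ l.map Prod.fst := h ▸ List.mem_map_of_mem hb
    obtain ⟨c, hc, hcb⟩ := List.mem_map.1 this
    exact ⟨c, hc, hcb ▸ hi⟩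

theorem abs_ofMapFst (s : LSetComp n M) (l : List (Finset (Fin n) × L))
    (h : l.map Prod.fst = s.blocks.map Prod.fst) : (s.ofMapFst l h).abs = s.abs :=
  abs_eq_abs_iff.2 h

/-- The set composition `x` with labels given by a function of the block. -/
def withLabels (x : SetComp n) (f : Finset (Fin n) → L) : LSetComp n L :=
  x.ofMapFst (x.blocks.map fun b => (b.1, f b.1)) (by simp [Function.comp_def])

theorem abs_of_setComp (x : SetComp n) : x.abs = x :=
  LSetComp.ext (List.map_id _)

@[simp]
theorem abs_withLabels (x : SetComp n) (f : Finset (Fin n) → L) : (x.withLabels f).abs = x :=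
  (abs_ofMapFst _ _ _).trans x.abs_of_setComp

/-- The label of a block, and `1` for sets that are not blocks. -/
noncomputable def lab [One L] (s : LSetComp n L) (A : Finset (Fin n)) : L :=
  if h : ∃ b ∈ s.blocks, b.1 = A then h.choose.2 else 1

theorem eq_of_fst_eq (s : LSetComp n L) {a b : Finset (Fin n) × L} (ha : a ∈ s.blocks)
    (hb : b ∈ s.blocks) (h : a.1 = b.1) : a = b :=
  s.block_eq_of_inter_nonempty ha hb (by rw [h, Finset.inter_self]; exact s.nonempty b hb)

theorem lab_eq [One L] {s : LSetComp n L} {b : Finset (Fin n) × L} (hb : b ∈ s.blocks) :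
    s.lab b.1 = b.2 := by
  have h : ∃ c ∈ s.blocks, c.1 = b.1 := ⟨b, hb, rfl⟩
  rw [lab, dif_pos h, s.eq_of_fst_eq h.choose_spec.1 hb h.choose_spec.2]

theorem withLabels_lab [One L] (s : LSetComp n L) : s.abs.withLabels s.lab = s := by
  apply LSetComp.ext
  change (s.blocks.map _).map _ = _
  rw [List.map_map]
  refine Eq.trans (List.map_congr_left fun b hb => ?_) (List.map_id s.blocks)
  exact Prod.ext rfl (lab_eq hb)

theorem lab_withLabels [One L] {x : SetComp n} {f : Finset (Fin n) → L} {A : Finset (Fin n)}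
    (hA : A ∈ x.supp.parts) : (x.withLabels f).lab A = f A := by
  obtain ⟨b, hb, rfl⟩ := mem_supp.1 hA
  exact lab_eq (s := x.withLabels f) (List.mem_map.2 ⟨b, hb, rfl⟩)

theorem ext_lab [One L] {s t : LSetComp n L} (h : s.abs = t.abs)
    (hl : ∀ A ∈ s.supp.parts, s.lab A = t.lab A) : s = t := by
  rw [← withLabels_lab s, ← withLabels_lab t, ← h]
  apply LSetComp.ext
  refine List.map_congr_left fun b hb => Prod.ext rfl (hl _ ?_)
  rw [← supp_abs]
  exact mem_supp.2 ⟨b, hb, rfl⟩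

/-- Functions on the blocks of `x` correspond to the labelled set compositions over `x`. -/
theorem sum_abs_eq [One L] [Finite L] [Fintype L] {A : Type*} [AddCommMonoid A] (x : SetComp n)
    (F : LSetComp n L → A) : ∑ s : LSetComp n L with s.abs = x, F s =
      ∑ f : {B // B ∈ x.supp.parts} → L,
        F (x.withLabels fun B => if h : B ∈ x.supp.parts then f ⟨B, h⟩ else 1) := by
  refine Finset.sum_bij' (fun s _ B => s.lab B.1)
    (fun f _ => x.withLabels fun B => if h : B ∈ x.supp.parts then f ⟨B, h⟩ else 1) ?_ ?_ ?_ ?_ ?_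
  · simp
  · simp
  · intro s hs
    obtain rfl := (Finset.mem_filter.1 hs).2
    refine ext_lab (abs_withLabels _ _) fun A hA => ?_
    rw [← supp_abs, abs_withLabels] at hA
    rw [lab_withLabels hA, dif_pos hA]
  · intro f _
    funext B
    rw [lab_withLabels B.2, dif_pos B.2]
  · intro s hs
    obtain rfl := (Finset.mem_filter.1 hs).2
    congr 1
    refine (ext_lab (abs_withLabels _ _) fun A hA => ?_).symm
    rw [← supp_abs, abs_withLabels] at hA
    rw [lab_withLabels hA, dif_pos hA]

theorem prod_blocks_eq {R : Type*} [CommMonoid R] (s : LSetComp n L) (f : Finset (Fin n) → R) :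
    (s.blocks.map fun b => f b.1).prod = ∏ B ∈ s.supp.parts, f B := by
  have : s.supp.parts = (s.blocks.map Prod.fst).toFinset := by
    ext A
    simp [mem_supp]
  rw [this, List.prod_toFinset _ s.nodup_map_fst, List.map_map]
  rfl

theorem eval_eq_prod_lab {G : Type*} [CommGroup G] {φ : LSetComp n (CharGroup G)}
    {s : LSetComp n G} (h : φ.abs = s.abs) :
    φ.eval s = ∏ B ∈ s.supp.parts, ((φ.lab B (s.lab B) : ℂˣ) : ℂ) := by
  rw [eval, if_pos h, ← prod_blocks_eq]
  congr 1
  conv_lhs => rw [← withLabels_lab φ, h]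
  change List.zipWith _ ((s.blocks.map _).map _) _ = _
  rw [List.map_map, List.zipWith_map_left, List.zipWith_self]
  exact List.map_congr_left fun b hb => by simp [lab_eq hb]

/-! ### Refinement in terms of labels -/

/-- A cut of the unlabelled blocks is also a cut of the labelled ones. -/
theorem exists_isRuns_of_abs_le {s : LSetComp n L} {t : LSetComp n M} (h : s.abs ≤ t.abs) :
    ∃ gs, IsRuns s t gs := by
  obtain ⟨gs, h1, h2⟩ := h
  have hr : List.Forall₂ (fun c (b : Finset (Fin n) × M) => c = (b.1, ())) gs.flatten t.blocks := by
    rw [h1, ← List.forall₂_map_right_iff, List.forall₂_eq_eq_eq]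
    rfl
  obtain ⟨ks, hk, hks⟩ := List.exists_flatten_of_forall₂ hr
  obtain rfl : gs = ks.map (List.map fun b => (b.1, ())) := by
    rw [← List.forall₂_eq_eq_eq, List.forall₂_map_right_iff]
    refine hks.imp fun a b hab => ?_
    rw [← List.forall₂_eq_eq_eq, List.forall₂_map_right_iff]
    exact hab
  refine ⟨ks, hk, ?_⟩
  change List.Forall₂ _ (s.blocks.map _) _ at h2
  rw [List.forall₂_map_right_iff, List.forall₂_map_left_iff] at h2
  exact h2.imp fun a g h => by simpa using h.1

theorem IsRuns.abs_le {s : LSetComp n L} {t : LSetComp n M}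
    {gs : List (List (Finset (Fin n) × M))} (h : IsRuns s t gs) : s.abs ≤ t.abs := by
  refine ⟨gs.map (List.map fun b => (b.1, ())), ?_, ?_⟩
  · rw [← List.map_flatten, h.1]
    rfl
  · change List.Forall₂ _ (s.blocks.map _) _
    rw [List.forall₂_map_right_iff, List.forall₂_map_left_iff]
    exact h.2.imp fun a g h => ⟨by simpa using h, by simp⟩

theorem abs_le_of_le {s t : LSetComp n L} (h : s ≤ t) : s.abs ≤ t.abs := by
  obtain ⟨gs, h, -⟩ := le_iff_isRuns.1 h
  exact h.abs_le

theorem abs_le_of_mulLE [CommMonoid L] {s t : LSetComp n L} (h : s.MulLE t) : s.abs ≤ t.abs := by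
  obtain ⟨gs, h, -⟩ := refines_iff_isRuns.1 (mulLE_iff_refines.1 h)
  exact h.abs_le

theorem refines_iff_of_isRuns {C : L → List L → Prop} {s t : LSetComp n L}
    {gs : List (List (Finset (Fin n) × L))} (h : IsRuns s t gs) :
    Refines C s t ↔ List.Forall₂ (fun a g => C a.2 (g.map Prod.snd)) s.blocks gs := by
  rw [refines_iff_isRuns]
  constructor
  · rintro ⟨gs', h', hl⟩
    rwa [h.unique h']
  · exact fun hl => ⟨gs, h, hl⟩

/-- Replace a relation between blocks and runs by a statement on all blocks. -/
theorem forall₂_blocks_iff [One L] {s : LSetComp n L} {gs : List M}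
    {r : Finset (Fin n) × L → M → Prop} {p : Finset (Fin n) → L → Prop}
    (hr : List.Forall₂ (fun a g => r a g ↔ p a.1 a.2) s.blocks gs) :
    List.Forall₂ r s.blocks gs ↔ ∀ A ∈ s.supp.parts, p A (s.lab A) := by
  have : (∀ A ∈ s.supp.parts, p A (s.lab A)) ↔ ∀ a ∈ s.blocks, p a.1 a.2 := by
    constructor
    · intro h a ha
      rw [← lab_eq ha]
      exact h _ (mem_supp.2 ⟨a, ha, rfl⟩)
    · intro h A hA
      obtain ⟨a, ha, rfl⟩ := mem_supp.1 hA
      rw [lab_eq ha]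
      exact h a ha
  rw [this]
  clear this
  generalize s.blocks = l at hr
  induction hr with
  | nil => simp
  | cons h _ ih => simp only [List.forall₂_cons, List.forall_mem_cons, ih, h]

/-- Once the underlying compositions refine each other, the order of the blocks plays no further
role and the relation concerns labels alone. -/
theorem le_iff_lab [One L] {s t : LSetComp n L} (h : s.abs ≤ t.abs) :
    s ≤ t ↔ ∀ A ∈ s.supp.parts, ∀ B ∈ t.supp.parts, B ⊆ A → t.lab B = s.lab A := by
  obtain ⟨gs, h⟩ := exists_isRuns_of_abs_le h
  rw [le_iff_refines, refines_iff_of_isRuns h]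
  refine forall₂_blocks_iff (p := fun A l => ∀ B ∈ t.supp.parts, B ⊆ A → t.lab B = l)
    (h.mem_iff.imp fun a g hg => ?_)
  rw [List.forall_mem_map]
  constructor
  · intro h1 B hB hBA
    obtain ⟨b, hb, rfl⟩ := mem_supp.1 hB
    rw [lab_eq hb]
    exact h1 b ((hg b).2 ⟨hb, hBA⟩)
  · intro h1 b hb
    rw [← lab_eq ((hg b).1 hb).1]
    exact h1 _ (mem_supp.2 ⟨b, ((hg b).1 hb).1, rfl⟩) ((hg b).1 hb).2

theorem mulLE_iff_lab [CommMonoid L] {s t : LSetComp n L} (h : s.abs ≤ t.abs) :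
    s.MulLE t ↔ ∀ A ∈ s.supp.parts, s.lab A = ∏ B ∈ t.supp.parts with B ⊆ A, t.lab B := by
  obtain ⟨gs, h⟩ := exists_isRuns_of_abs_le h
  rw [mulLE_iff_refines, refines_iff_of_isRuns h]
  refine forall₂_blocks_iff (p := fun A l => l = ∏ B ∈ t.supp.parts with B ⊆ A, t.lab B) ?_
  have hmem := h.mem_iff
  refine List.forall₂_iff_get.2 ⟨h.length_eq, fun j hj hj' => ?_⟩
  have hg := (List.forall₂_iff_get.1 hmem).2 j hj hj'
  have hsub : ∀ g ∈ gs, (g.map Prod.fst).Nodup := by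
    intro g hg
    have hn := t.nodup_map_fst
    rw [← h.1, List.map_flatten, List.nodup_flatten] at hn
    exact hn.1 _ (List.mem_map_of_mem hg)
  -- Commutativity lets the ordered product along the run be taken over the set of blocks contained
  -- in the `j`-th block of `s`.
  have key : ((gs.get ⟨j, hj'⟩).map Prod.snd).prod =
      ∏ B ∈ t.supp.parts with B ⊆ (s.blocks.get ⟨j, hj⟩).1, t.lab B := by
    have hset : (t.supp.parts.filter fun B => B ⊆ (s.blocks.get ⟨j, hj⟩).1) =
        ((gs.get ⟨j, hj'⟩).map Prod.fst).toFinset := by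
      ext B
      simp only [Finset.mem_filter, mem_supp, List.mem_toFinset, List.mem_map, hg]
      constructor
      · rintro ⟨⟨b, hb, rfl⟩, hB⟩
        exact ⟨b, ⟨hb, hB⟩, rfl⟩
      · rintro ⟨b, ⟨hb, hB⟩, rfl⟩
        exact ⟨⟨b, hb, rfl⟩, hB⟩
    rw [hset, List.prod_toFinset _ (hsub _ (List.get_mem _ _)), List.map_map]
    congr 1
    exact List.map_congr_left fun b hb => (lab_eq ((hg b).1 hb).1).symm
  rw [key]

end LSetComp

/-! ### Fourier analysis of the labels -/

section Characters

open ComplexConjugate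

variable {G : Type*} [CommGroup G]

theorem CharGroup.conj_apply [Finite G] (φ : CharGroup G) (g : G) :
    conj ((φ g : ℂˣ) : ℂ) = ((φ⁻¹ g : ℂˣ) : ℂ) := by
  have h : ‖((φ g : ℂˣ) : ℂ)‖ = 1 := by
    have h1 : IsOfFinOrder ((φ g : ℂˣ) : ℂ) :=
      ((Units.coeHom ℂ).comp φ).isOfFinOrder (isOfFinOrder_of_finite g)
    exact h1.norm_eq_one
  rw [MonoidHom.inv_apply, Units.val_inv_eq_inv_val, Complex.inv_def, Complex.normSq_eq_norm_sq, h]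
  simp

theorem CharGroup.sum_conj_mul [Fintype G] (φ χ : CharGroup G) :
    ∑ g : G, conj ((φ g : ℂˣ) : ℂ) * ((χ g : ℂˣ) : ℂ) =
      if φ = χ then (Nat.card G : ℂ) else 0 := by
  have h := sum_hom_units ((Units.coeHom ℂ).comp (φ⁻¹ * χ))
  rw [Nat.card_eq_fintype_card]
  have h1 : (Units.coeHom ℂ).comp (φ⁻¹ * χ) = 1 ↔ φ = χ := by
    rw [← inv_mul_eq_one (a := φ), DFunLike.ext_iff, DFunLike.ext_iff (f := φ⁻¹ * χ)]
    refine forall_congr' fun g => ?_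
    rw [Units.ext_iff]
    rfl
  simp only [h1] at h
  push_cast at h
  rw [← h]
  refine Finset.sum_congr rfl fun g _ => ?_
  rw [CharGroup.conj_apply]
  simp

/-- This is orthogonality on the dual group, applied to evaluation at `g * h⁻¹`: characters separate
points, and `G` has as many characters as elements. -/
theorem CharGroup.sum_mul_conj [Finite G] [Fintype (CharGroup G)] (g h : G) :
    ∑ φ : CharGroup G, ((φ g : ℂˣ) : ℂ) * conj ((φ h : ℂˣ) : ℂ) =
      if g = h then (Nat.card G : ℂ) else 0 := by
  have hs := sum_hom_units ((Units.coeHom ℂ).comp (MonoidHom.eval (N := ℂˣ) (g * h⁻¹)))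
  have h1 : (Units.coeHom ℂ).comp (MonoidHom.eval (N := ℂˣ) (g * h⁻¹)) = 1 ↔ g = h := by
    rw [← CommGroup.forall_apply_eq_apply_iff G (M := ℂ), DFunLike.ext_iff]
    refine forall_congr' fun φ => ?_
    rw [← mul_inv_eq_one (a := φ g), ← map_inv, ← map_mul, Units.ext_iff]
    rfl
  simp only [h1] at hs
  rw [← CommGroup.card_monoidHom_of_hasEnoughRootsOfUnity G ℂ, Nat.card_eq_fintype_card]
  push_cast at hs
  rw [← hs]
  refine Finset.sum_congr rfl fun φ _ => ?_
  rw [CharGroup.conj_apply]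
  simp

end Characters

/-! ### Orthogonality and duality for labelled compositions -/

namespace LSetComp

open ComplexConjugate

variable {n : ℕ}

theorem sum_abs_prod {L : Type*} [One L] [Fintype L] (x : SetComp n)
    (h : Finset (Fin n) → L → ℂ) :
    ∑ s : LSetComp n L with s.abs = x, ∏ B ∈ x.supp.parts, h B (s.lab B) =
      ∏ B ∈ x.supp.parts, ∑ l, h B l := by
  rw [sum_abs_eq, ← Finset.prod_coe_sort, Finset.prod_univ_sum, Fintype.piFinset_univ]
  refine Finset.sum_congr rfl fun f _ => ?_
  rw [← Finset.prod_coe_sort]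
  refine Finset.prod_congr rfl fun B _ => ?_
  rw [lab_withLabels B.2, dif_pos B.2]

theorem eq_iff_lab {L : Type*} [One L] {s t : LSetComp n L} (h : s.abs = t.abs) :
    s = t ↔ ∀ A ∈ s.supp.parts, s.lab A = t.lab A :=
  ⟨by rintro rfl; simp, ext_lab h⟩

/-- Copy the labels of `s` to the blocks of a refinement `y` of `|s|`. -/
noncomputable def inflate {L : Type*} [CommMonoid L] (s : LSetComp n L) (y : SetComp n) :
    LSetComp n L :=
  -- A block of a refinement of `|s|` lies in exactly one `A`, so the product has one factor.
  -- Written as a product, it mirrors `merge`.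
  y.withLabels fun B => ∏ A ∈ s.supp.parts with B ⊆ A, s.lab A

/-- Multiply the labels of `t` within the blocks of a coarsening `x` of `|t|`. -/
noncomputable def merge {L : Type*} [CommMonoid L] (t : LSetComp n L) (x : SetComp n) :
    LSetComp n L :=
  x.withLabels fun A => ∏ B ∈ t.supp.parts with B ⊆ A, t.lab B

theorem abs_inflate {L : Type*} [CommMonoid L] (s : LSetComp n L) (y : SetComp n) :
    (s.inflate y).abs = y :=
  abs_withLabels _ _

theorem abs_merge {L : Type*} [CommMonoid L] (t : LSetComp n L) (x : SetComp n) :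
    (t.merge x).abs = x :=
  abs_withLabels _ _

theorem le_iff_eq_inflate {L : Type*} [CommMonoid L] {s t : LSetComp n L} (h : s.abs ≤ t.abs) :
    s ≤ t ↔ s.inflate t.abs = t := by
  have hs : (s.inflate t.abs).supp = t.supp := by
    rw [← supp_abs, abs_inflate, supp_abs]
  rw [le_iff_lab h, eq_iff_lab (abs_inflate _ _), hs, inflate]
  have hsupp := supp_le_of_le h
  rw [supp_abs, supp_abs] at hsupp
  have key : ∀ A ∈ s.supp.parts, ∀ B ∈ t.supp.parts, B ⊆ A →
      ∏ A ∈ s.supp.parts with B ⊆ A, s.lab A = s.lab A := by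
    intro A hA B hB hBA
    rw [Finset.prod_eq_single_of_mem A (by simp [hA, hBA])]
    intro A' hA' hne
    obtain ⟨hA', hBA'⟩ := Finset.mem_filter.1 hA'
    obtain ⟨i, hi⟩ := t.supp.nonempty_of_mem_parts hB
    exact absurd (s.supp.eq_of_mem_parts hA' hA (hBA' hi) (hBA hi)) hne
  constructor
  · intro h1 B hB
    obtain ⟨A, hA, hBA⟩ := hsupp hB
    rw [lab_withLabels (by rwa [supp_abs]), key A hA B hB hBA, h1 A hA B hB hBA]
  · intro h1 A hA B hB hBA
    rw [← h1 B hB, lab_withLabels (by rwa [supp_abs]), key A hA B hB hBA]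

theorem mulLE_iff_eq_merge {L : Type*} [CommMonoid L] {s t : LSetComp n L} (h : s.abs ≤ t.abs) :
    s.MulLE t ↔ s = t.merge s.abs := by
  rw [mulLE_iff_lab h, eq_iff_lab (abs_merge _ _).symm]
  refine forall₂_congr fun A hA => ?_
  rw [merge, lab_withLabels (by rwa [supp_abs])]

/-- Both sides are the product of `ψ_B(s_A)` over all pairs of blocks with `B ⊆ A`. -/
theorem eval_inflate {G : Type*} [CommGroup G] (ψ : LSetComp n (CharGroup G)) (s : LSetComp n G) :
    ψ.eval (s.inflate ψ.abs) = (ψ.merge s.abs).eval s := by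
  rw [eval_eq_prod_lab (abs_inflate _ _).symm, eval_eq_prod_lab (abs_merge _ _)]
  have h1 : (s.inflate ψ.abs).supp = ψ.supp := by
    rw [← supp_abs, abs_inflate, supp_abs]
  have e1 : ∀ B ∈ ψ.supp.parts, ((ψ.lab B ((s.inflate ψ.abs).lab B) : ℂˣ) : ℂ) =
      ∏ A ∈ s.supp.parts with B ⊆ A, ((ψ.lab B (s.lab A) : ℂˣ) : ℂ) := by
    intro B hB
    rw [inflate, lab_withLabels (by rwa [supp_abs]), map_prod, Units.coe_prod]
  have e2 : ∀ A ∈ s.supp.parts, (((ψ.merge s.abs).lab A (s.lab A) : ℂˣ) : ℂ) =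
      ∏ B ∈ ψ.supp.parts with B ⊆ A, ((ψ.lab B (s.lab A) : ℂˣ) : ℂ) := by
    intro A hA
    rw [merge, lab_withLabels (by rwa [supp_abs]), MonoidHom.finsetProd_apply, Units.coe_prod]
  rw [h1, Finset.prod_congr rfl e1, Finset.prod_congr rfl e2]
  refine Finset.prod_comm' fun B A => ?_
  simp only [Finset.mem_filter]
  tauto

variable {G : Type*} [CommGroup G] [Finite G]

theorem sum_conj_eval_mul_eval {φ χ : LSetComp n (CharGroup G)} (h : φ.abs = χ.abs) :
    ∑ s : LSetComp n G with s.abs = φ.abs, conj (φ.eval s) * χ.eval s =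
      if φ = χ then (Nat.card G : ℂ) ^ φ.length else 0 := by
  have := Fintype.ofFinite G
  have e : ∀ s ∈ Finset.univ.filter (fun s : LSetComp n G => s.abs = φ.abs),
      conj (φ.eval s) * χ.eval s = ∏ B ∈ φ.abs.supp.parts,
        (conj ((φ.lab B (s.lab B) : ℂˣ) : ℂ) * ((χ.lab B (s.lab B) : ℂˣ) : ℂ)) := by
    intro s hs
    have hs := (Finset.mem_filter.1 hs).2
    rw [eval_eq_prod_lab hs.symm, eval_eq_prod_lab (h.symm.trans hs.symm), map_prod,
      ← Finset.prod_mul_distrib, ← hs, supp_abs]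
  rw [Finset.sum_congr rfl e, sum_abs_prod φ.abs
    fun B g => conj ((φ.lab B g : ℂˣ) : ℂ) * ((χ.lab B g : ℂˣ) : ℂ)]
  simp only [CharGroup.sum_conj_mul, Finset.prod_ite_zero, Finset.prod_const, supp_abs,
    card_supp, eq_iff_lab h]
  rfl

theorem sum_eval_mul_conj_eval {s t : LSetComp n G} (h : s.abs = t.abs) :
    ∑ φ : LSetComp n (CharGroup G) with φ.abs = s.abs, φ.eval s * conj (φ.eval t) =
      if s = t then (Nat.card G : ℂ) ^ s.length else 0 := by
  have := Fintype.ofFinite (CharGroup G)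
  have e : ∀ φ ∈ Finset.univ.filter (fun φ : LSetComp n (CharGroup G) => φ.abs = s.abs),
      φ.eval s * conj (φ.eval t) = ∏ B ∈ s.abs.supp.parts,
        (((φ.lab B (s.lab B) : ℂˣ) : ℂ) * conj ((φ.lab B (t.lab B) : ℂˣ) : ℂ)) := by
    intro φ hφ
    have hφ := (Finset.mem_filter.1 hφ).2
    rw [eval_eq_prod_lab hφ, eval_eq_prod_lab (hφ.trans h), map_prod, ← supp_abs t, ← h,
      supp_abs, ← Finset.prod_mul_distrib]
  rw [Finset.sum_congr rfl e, sum_abs_prod s.abs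
    fun B (φ : CharGroup G) => ((φ (s.lab B) : ℂˣ) : ℂ) * conj ((φ (t.lab B) : ℂˣ) : ℂ)]
  simp only [CharGroup.sum_mul_conj, Finset.prod_ite_zero, Finset.prod_const, supp_abs,
    card_supp, eq_iff_lab h]
  rfl

theorem card_pow_ne_zero (k : ℕ) : (Nat.card G : ℂ) ^ k ≠ 0 :=
  pow_ne_zero _ (Nat.cast_ne_zero.2 Nat.card_pos.ne')

/-- Duality between the two refinement orders. -/
theorem sum_conj_eval_le (φ : LSetComp n (CharGroup G)) (t : LSetComp n G) :
    1 / (Nat.card G : ℂ) ^ φ.length *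
        ∑ s : LSetComp n G with s.abs = φ.abs ∧ s ≤ t, conj (φ.eval s) =
      1 / (Nat.card G : ℂ) ^ t.length *
        ∑ ψ : LSetComp n (CharGroup G) with ψ.abs = t.abs ∧ φ.MulLE ψ, conj (ψ.eval t) := by
  by_cases hle : φ.abs ≤ t.abs
  · have e1 : ∑ ψ : LSetComp n (CharGroup G) with ψ.abs = t.abs ∧ φ.MulLE ψ, conj (ψ.eval t) =
        1 / (Nat.card G : ℂ) ^ φ.length * ∑ ψ : LSetComp n (CharGroup G) with ψ.abs = t.abs,
          ∑ s : LSetComp n G with s.abs = φ.abs,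
            conj (φ.eval s) * (ψ.eval (s.inflate t.abs) * conj (ψ.eval t)) := by
      rw [← Finset.filter_filter, Finset.sum_filter, Finset.mul_sum]
      refine Finset.sum_congr rfl fun ψ hψ => ?_
      have hψ := (Finset.mem_filter.1 hψ).2
      have h1 : ∀ s ∈ Finset.univ.filter (fun s : LSetComp n G => s.abs = φ.abs),
          conj (φ.eval s) * (ψ.eval (s.inflate t.abs) * conj (ψ.eval t)) =
            (conj (φ.eval s) * (ψ.merge φ.abs).eval s) * conj (ψ.eval t) := by
        intro s hs
        rw [← hψ, eval_inflate, (Finset.mem_filter.1 hs).2, mul_assoc]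
      rw [Finset.sum_congr rfl h1, ← Finset.sum_mul,
        sum_conj_eval_mul_eval (abs_merge _ _).symm,
        mulLE_iff_eq_merge (hψ ▸ hle)]
      split_ifs with h2
      · rw [← mul_assoc, one_div_mul_cancel (card_pow_ne_zero _), one_mul]
      · simp
    -- After the exchange of sums, dual orthogonality over `ψ` leaves the indicator of `s.inflate
    -- t.abs = t`, that is, of `s ≤ t`.
    have e2 : ∀ s ∈ Finset.univ.filter (fun s : LSetComp n G => s.abs = φ.abs),
        ∑ ψ : LSetComp n (CharGroup G) with ψ.abs = t.abs,
            conj (φ.eval s) * (ψ.eval (s.inflate t.abs) * conj (ψ.eval t)) =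
          if s ≤ t then (Nat.card G : ℂ) ^ t.length * conj (φ.eval s) else 0 := by
      intro s hs
      have hs := (Finset.mem_filter.1 hs).2
      have ha : (s.inflate t.abs).abs = t.abs := abs_inflate _ _
      have h1 := sum_eval_mul_conj_eval ha
      rw [ha] at h1
      have hl : s.inflate t.abs = t →
          (Nat.card G : ℂ) ^ (s.inflate t.abs).length = (Nat.card G : ℂ) ^ t.length := by
        intro h
        rw [h]
      rw [← Finset.mul_sum, h1, le_iff_eq_inflate (hs ▸ hle)]
      split_ifs with h2
      · rw [hl h2, mul_comm]
      · rw [mul_zero]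
    rw [e1, Finset.sum_comm, Finset.sum_congr rfl e2, ← Finset.sum_filter, Finset.filter_filter,
      ← Finset.mul_sum]
    have := card_pow_ne_zero (G := G) t.length
    field_simp
  · rw [Finset.filter_false_of_mem, Finset.filter_false_of_mem]
    · simp
    · rintro ψ - ⟨h1, h2⟩
      exact hle (h1 ▸ abs_le_of_mulLE h2)
    · rintro s - ⟨h1, h2⟩
      exact hle (h1 ▸ abs_le_of_le h2)

/-- The isotypic combination `|G|^{-ℓ} ∑ conj (φ s) F s` of a family `F`. -/
noncomputable def isotypic {A : Type*} [AddCommGroup A] [Module ℂ A] (F : LSetComp n G → A)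
    (φ : LSetComp n (CharGroup G)) : A :=
  (1 / (Nat.card G : ℂ) ^ φ.length) • ∑ s : LSetComp n G with s.abs = φ.abs, conj (φ.eval s) • F s

theorem length_abs {L : Type*} (s : LSetComp n L) : s.abs.length = s.length :=
  List.length_map _

theorem length_eq_of_abs_eq {L M : Type*} {s : LSetComp n L} {t : LSetComp n M}
    (h : s.abs = t.abs) : s.length = t.length := by
  rw [← length_abs, h, length_abs]

/-- As `c` ignores labels, it factors out of the coefficient of `F t` on each side; what remains is
`sum_conj_eval_le`. -/
theorem isotypic_sum_le {A : Type*} [AddCommGroup A] [Module ℂ A] (c : SetComp n → SetComp n → ℂ)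
    {F K : LSetComp n G → A}
    (h : ∀ s, K s = ∑ t : LSetComp n G with s ≤ t, c s.abs t.abs • F t)
    (φ : LSetComp n (CharGroup G)) :
    isotypic K φ = ∑ ψ : LSetComp n (CharGroup G) with φ.MulLE ψ,
      c φ.abs ψ.abs • isotypic F ψ := by
  have e1 : isotypic K φ = ∑ t : LSetComp n G, (c φ.abs t.abs *
      (1 / (Nat.card G : ℂ) ^ φ.length *
        ∑ s : LSetComp n G with s.abs = φ.abs ∧ s ≤ t, conj (φ.eval s))) • F t := by
    simp only [isotypic, h, Finset.smul_sum, Finset.mul_sum, Finset.sum_smul, smul_smul]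
    rw [Finset.sum_comm' (s' := fun t => Finset.univ.filter fun s : LSetComp n G =>
      s.abs = φ.abs ∧ s ≤ t) (t' := Finset.univ) (by simp)]
    refine Finset.sum_congr rfl fun t _ => Finset.sum_congr rfl fun s hs => ?_
    rw [(Finset.mem_filter.1 hs).2.1]
    congr 1
    ring
  have e2 : ∑ ψ : LSetComp n (CharGroup G) with φ.MulLE ψ, c φ.abs ψ.abs • isotypic F ψ =
      ∑ t : LSetComp n G, (c φ.abs t.abs * (1 / (Nat.card G : ℂ) ^ t.length *
        ∑ ψ : LSetComp n (CharGroup G) with ψ.abs = t.abs ∧ φ.MulLE ψ, conj (ψ.eval t))) •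
          F t := by
    simp only [isotypic, Finset.smul_sum, Finset.mul_sum, Finset.sum_smul, smul_smul]
    rw [Finset.sum_comm' (s' := fun t => Finset.univ.filter fun ψ : LSetComp n (CharGroup G) =>
      ψ.abs = t.abs ∧ φ.MulLE ψ) (t' := Finset.univ) (by simp [and_comm, eq_comm])]
    refine Finset.sum_congr rfl fun t _ => Finset.sum_congr rfl fun ψ hψ => ?_
    rw [(Finset.mem_filter.1 hψ).2.1, length_eq_of_abs_eq (Finset.mem_filter.1 hψ).2.1]
  rw [e1, e2]
  simp only [sum_conj_eval_le]

end LSetComp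

/-! ### Types of labelled compositions and label-free coefficients -/

namespace LSetComp

open ComplexConjugate

variable {n : ℕ} {G : Type*} [CommGroup G]

theorem type_abs_eq_iff {L M : Type*} {p : LIntComp n L} {q : LIntComp n M} :
    p.abs = q.abs ↔ p.blocks.map Prod.fst = q.blocks.map Prod.fst :=
  Composition.ext_iff

theorem type_abs_of_abs_eq {L M : Type*} {s : LSetComp n L} {t : LSetComp n M}
    (h : s.abs = t.abs) : s.type.abs = t.type.abs := by
  rw [type_abs_eq_iff]
  have := congrArg (List.map Finset.card) (abs_eq_abs_iff.1 h)
  simpa [type, Function.comp_def] using this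

theorem eval_type {φ : LSetComp n (CharGroup G)} {s : LSetComp n G} (h : φ.abs = s.abs) :
    φ.type.eval s.type = φ.eval s := by
  rw [eval, LIntComp.eval, if_pos h, if_pos (type_abs_of_abs_eq h)]
  simp [type, List.zipWith_map]

theorem relDegFactorial_eq_abs {L : Type*} (t s : LSetComp n L) :
    t.relDegFactorial s = t.abs.relDegFactorial s.abs := by
  rw [relDegFactorial, relDegFactorial, type_abs_of_abs_eq t.abs.abs_of_setComp.symm,
    type_abs_of_abs_eq s.abs.abs_of_setComp.symm,
    type_abs_of_abs_eq (abs_of_setComp t.abs), type_abs_of_abs_eq (abs_of_setComp s.abs)]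

theorem relDeg_eq_abs {L : Type*} (t s : LSetComp n L) : t.relDeg s = t.abs.relDeg s.abs := by
  rw [relDeg, relDeg, type_abs_of_abs_eq t.abs.abs_of_setComp.symm,
    type_abs_of_abs_eq s.abs.abs_of_setComp.symm,
    type_abs_of_abs_eq (abs_of_setComp t.abs), type_abs_of_abs_eq (abs_of_setComp s.abs)]

/-- Each `s` carries a unique labelling of a given compatible type. -/
theorem existsUnique_type_eq {L M : Type*} {α : LIntComp n L} {s : LSetComp n M}
    (h : s.type.abs = α.abs) : ∃! φ : LSetComp n L, φ.type = α ∧ φ.abs = s.abs := by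
  have hb : s.blocks.map (fun b => b.1.card) = α.blocks.map Prod.fst := by
    simpa [type, Function.comp_def] using type_abs_eq_iff.1 h
  have hlen : s.blocks.length = α.blocks.length := by simpa using congrArg List.length hb
  let l := List.zipWith (fun (b : Finset (Fin n) × M) (a : ℕ × L) => (b.1, a.2)) s.blocks α.blocks
  have hl : l.map Prod.fst = s.blocks.map Prod.fst := by
    refine List.ext_getElem (by simp [l, hlen]) fun i h1 h2 => ?_
    simp [l]
  refine ⟨s.ofMapFst l hl, ⟨LIntComp.ext ?_, abs_ofMapFst _ _ _⟩, ?_⟩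
  · change l.map _ = _
    refine List.ext_getElem (by simp [l, hlen]) fun i h1 h2 => ?_
    have h3 : i < s.blocks.length := hlen ▸ h2
    have := List.getElem_of_eq hb (i := i) (by simpa using h3)
    refine Prod.ext ?_ ?_
    · simpa [l] using this
    · simp [l]
  · rintro φ ⟨rfl, hφ⟩
    apply LSetComp.ext
    change _ = l
    have hφ := abs_eq_abs_iff.1 hφ
    have hlen' : φ.blocks.length = s.blocks.length := by simpa using congrArg List.length hφ
    have hlt : φ.type.blocks.length = φ.blocks.length := List.length_map _
    refine List.ext_getElem (by rw [List.length_zipWith, hlt, hlen', min_self]) fun i h1 h2 => ?_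
    have := List.getElem_of_eq hφ (i := i) (by simpa using h1)
    refine Prod.ext ?_ ?_
    · simpa [l] using this
    · simp [l, type]

end LSetComp

namespace Hsiao

open ComplexConjugate

/-! ### The bases `E` and `Q` -/

variable {n : ℕ} {G : Type*} [CommGroup G] [Finite G]

theorem E_eq_isotypic (φ : LSetComp n (CharGroup G)) : E φ = LSetComp.isotypic H φ := rfl

/-- For `|s| = |φ|`, the idempotent `|φ|` acts trivially on the right of `s`, so each term `H_s
Q°_{|φ|}` is `R_s`. -/
theorem Q_eq_isotypic (φ : LSetComp n (CharGroup G)) : Q φ = LSetComp.isotypic R φ := by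
  rw [Q, E, LSetComp.isotypic, smul_mul_assoc, Finset.sum_mul]
  congr 1
  refine Finset.sum_congr rfl fun s hs => ?_
  have hs := (Finset.mem_filter.1 hs).2
  rw [smul_mul_assoc, Q₀, ← mul_assoc, H_mul_H_ofSetComp, ← hs,
    LSetComp.mul_ofSetComp_of_supp_eq s.supp_abs, R]

theorem E_eq_sum_Q (φ : LSetComp n (CharGroup G)) :
    E φ = ∑ ψ : LSetComp n (CharGroup G) with φ.MulLE ψ,
      (1 / (ψ.relDegFactorial φ : ℂ)) • Q ψ := by
  have h := LSetComp.isotypic_sum_le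
    (fun x y => 1 / (y.relDegFactorial x : ℂ)) (F := R) (K := H (G := G))
    (fun s => by simpa only [← LSetComp.relDegFactorial_eq_abs] using H_eq_sum_R s) φ
  simpa only [← LSetComp.relDegFactorial_eq_abs, E_eq_isotypic, Q_eq_isotypic] using h

theorem Q_eq_sum_E (φ : LSetComp n (CharGroup G)) :
    Q φ = ∑ ψ : LSetComp n (CharGroup G) with φ.MulLE ψ,
      ((-1 : ℂ) ^ (ψ.length - φ.length) / (ψ.relDeg φ : ℂ)) • E ψ := by
  have h := LSetComp.isotypic_sum_le
    (fun x y => (-1 : ℂ) ^ (y.length - x.length) / (y.relDeg x : ℂ)) (F := H) (K := R (G := G))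
    (fun s => by simpa only [LSetComp.length_abs, ← LSetComp.relDeg_eq_abs] using R_eq_sum_H s) φ
  simpa only [LSetComp.length_abs, ← LSetComp.relDeg_eq_abs, E_eq_isotypic, Q_eq_isotypic] using h

theorem SQ_eq_sum_SR (α : LIntComp n (CharGroup G)) :
    SQ α = (1 / (Nat.card G : ℂ) ^ α.length) •
      ∑ p : LIntComp n G with p.abs = α.abs, conj (α.eval p) • SR p := by
  have e1 : SQ α = (1 / (Nat.card G : ℂ) ^ α.length) •
      ∑ φ : LSetComp n (CharGroup G) with φ.type = α, ∑ s : LSetComp n G with s.abs = φ.abs,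
        conj (φ.eval s) • R s := by
    rw [SQ, Finset.smul_sum]
    refine Finset.sum_congr rfl fun φ hφ => ?_
    rw [Q_eq_isotypic, LSetComp.isotypic, ← length_type, (Finset.mem_filter.1 hφ).2]
  rw [e1]
  congr 1
  simp only [SR, Finset.smul_sum]
  -- Both sides become sums over the `s` whose type lies over `|α|`; each such `s` meets one
  -- labelling `φ` of type `α` and one `p`, namely its type.
  rw [Finset.sum_comm' (s' := fun s => Finset.univ.filter
      fun φ : LSetComp n (CharGroup G) => φ.type = α ∧ φ.abs = s.abs)
      (t' := Finset.univ.filter fun s : LSetComp n G => s.type.abs = α.abs),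
    Finset.sum_comm' (s' := fun s => {s.type})
      (t' := Finset.univ.filter fun s : LSetComp n G => s.type.abs = α.abs)]
  · refine Finset.sum_congr rfl fun s hs => ?_
    obtain ⟨φ, ⟨h1, h2⟩, h3⟩ := LSetComp.existsUnique_type_eq (Finset.mem_filter.1 hs).2
    rw [Finset.sum_singleton, Finset.sum_eq_single_of_mem φ (by simp [h1, h2]),
      ← LSetComp.eval_type h2, h1]
    intro φ' hφ' hne
    exact absurd (h3 φ' (Finset.mem_filter.1 hφ').2) hne
  · intro p s
    simp only [Finset.mem_filter, Finset.mem_univ, true_and, Finset.mem_singleton]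
    constructor
    · rintro ⟨h, rfl⟩
      exact ⟨rfl, h⟩
    · rintro ⟨rfl, h⟩
      exact ⟨h, rfl⟩
  · intro φ s
    simp only [Finset.mem_filter, Finset.mem_univ, true_and]
    constructor
    · rintro ⟨rfl, h⟩
      exact ⟨⟨rfl, h.symm⟩, LSetComp.type_abs_of_abs_eq h⟩
    · rintro ⟨⟨rfl, h⟩, -⟩
      exact ⟨rfl, h.symm⟩

theorem SQ_eq_sum_SE (α : LIntComp n (CharGroup G)) :
    SQ α = ∑ β : LIntComp n (CharGroup G) with α.MulLE β,
      ((-1 : ℂ) ^ (β.length - α.length) / (β.abs.relDeg α.abs : ℂ)) • SE β := by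
  have h := LSetComp.sum_type_sum_refines (C := fun a l => a = l.prod)
    (fun p q : LIntComp n (CharGroup G) =>
      (-1 : ℂ) ^ (q.length - p.length) / (q.abs.relDeg p.abs : ℂ)) E α
  simp only [length_type] at h
  simp only [SQ, SE, Q_eq_sum_E, LSetComp.relDeg]
  exact h

end Hsiao

open Hsiao ComplexConjugate in
theorem mainTheorem8 (n : ℕ) :
    (∀ (G : Type*) [Group G] [Finite G],
      (∀ s : LSetComp n G,
        H s = ∑ t : LSetComp n G with s ≤ t, (1 / (t.relDegFactorial s : ℂ)) • R t ∧
        R s = ∑ t : LSetComp n G with s ≤ t,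
          ((-1 : ℂ) ^ (t.length - s.length) / (t.relDeg s : ℂ)) • H t) ∧
      (∀ p : LIntComp n G,
        SR p = ∑ q : LIntComp n G with p ≤ q,
          ((-1 : ℂ) ^ (q.length - p.length) / (q.abs.relDeg p.abs : ℂ)) • SH q)) ∧
    (∀ (G : Type*) [CommGroup G] [Finite G],
      (∀ φ : LSetComp n (CharGroup G),
        E φ = ∑ ψ : LSetComp n (CharGroup G) with φ.MulLE ψ,
          (1 / (ψ.relDegFactorial φ : ℂ)) • Q ψ ∧
        Q φ = ∑ ψ : LSetComp n (CharGroup G) with φ.MulLE ψ,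
          ((-1 : ℂ) ^ (ψ.length - φ.length) / (ψ.relDeg φ : ℂ)) • E ψ) ∧
      (∀ α : LIntComp n (CharGroup G),
        SQ α = (1 / (Nat.card G : ℂ) ^ α.length) •
          ∑ p : LIntComp n G with p.abs = α.abs, conj (α.eval p) • SR p ∧
        SQ α = ∑ β : LIntComp n (CharGroup G) with α.MulLE β,
          ((-1 : ℂ) ^ (β.length - α.length) / (β.abs.relDeg α.abs : ℂ)) • SE β)) := by
  refine ⟨fun G _ _ => ⟨fun s => ⟨H_eq_sum_R s, R_eq_sum_H s⟩, SR_eq_sum_SH⟩,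
    fun G _ _ => ⟨fun φ => ⟨E_eq_sum_Q φ, Q_eq_sum_E φ⟩, fun α => ⟨SQ_eq_sum_SR α, SQ_eq_sum_SE α⟩⟩⟩
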